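/- Theorem 1.2. Let $a,b,c$ be nonnegative integers with $b\le a\le c$. On the triangular lattice with unit steps $h=(1,0)$, $e=(\tfrac12,\tfrac{\sqrt3}2)$ and $f=e-h$, let $H(a,b,c)$ be the hexagon whose boundary, traversed counterclockwise starting from the left endpoint of its bottom side, consists of $b$ steps $h$, $a$ steps $e$, $c$ steps $f$, $b$ steps $-h$, $a$ steps $-e$ and $c$ steps $-f$. For each of the northwestern corner (where sides of lengths $b$ and $a$ meet) and the eastern corner (where sides of lengths $a$ and $c$ meet) do the following. Let $m,n$ be the lengths of the two sides meeting there, and for $i,j\ge 0$ let the lozenge at position $(i,j)$ be the unit rhombus, with sides parallel to these two sides, obtained from the one sitting in the corner by translating it $i$ units away from the corner along the direction of one of the sides and $j$ units along the direction of the other. Remove the maximal staircase, i.e. the lozenges at the positions with $i+j+1<\min(m,n)$. The tile positions along the resulting zig-zag cut (those fitting in its indentations) are the positions with $i,j\ge0$ and $i+j+1=\min(m,n)$. Let $H_{\mathrm d}(a,b,c)$ be the region that is left after both removals. A lozenge tiling of $H_{\mathrm d}(a,b,c)$ is a partition of it into lozenges, each a union of two unit lattice triangles sharing a side. Let $$L^*_*(H_{\mathrm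 d}(a,b,c))=\sum_T 2^{-k(T)},$$ where the sum is over all lozenge tilings $T$ of $H_{\mathrm d}(a,b,c)$, and $k(T)$ is the number of lozenges of $T$ that occupy tile positions along one of the two zig-zag cuts. Then $$L^*_*(H_{\mathrm d}(a,b,c))=2^{-a-b}\prod_{j=1}^{b}\frac{(j-1)!\,(a+c-b+2j-1)!\,(c-a+3j-1)_{b-j}\,(a+2c+3j-1)_{b-j+1}}{(b+c+j-1)!\,(a-b+2j-1)!},$$ where $(\alpha)_0:=1$ and $(\alpha)_k:=\alpha(\alpha+1)\cdots(\alpha+k-1)$ for $k\ge1$. -/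

import Mathlib

open scoped Nat

noncomputable section

namespace LozengeTiling

/-- Points of the triangular lattice: `(x, y)` stands for the point `x • h + y • e` of the plane,
where `h = (1, 0)` and `e = (1/2, √3/2)` are unit vectors at an angle of 60 degrees.
The third lattice direction, at 120 degrees to `h`, is `f = e - h`, i.e. `(-1, 1)`. -/
abbrev LatticePoint := ℤ × ℤ

/-- Unit triangles of the triangular lattice. `(x, y, true)` is the upward pointing triangle whose
lower left vertex is `(x, y)`; `(x, y, false)` is the downward pointing triangle sharing with it its
right side. See `vertices`. -/
abbrev UnitTriangle := ℤ × ℤ × Bool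

/-- The upward pointing unit triangle with lower left vertex `(x, y)`. -/
def up (x y : ℤ) : UnitTriangle := (x, y, true)

/-- The downward pointing unit triangle with upper right vertex `(x + 1, y + 1)`. -/
def down (x y : ℤ) : UnitTriangle := (x, y, false)

/-- The three vertices of a unit triangle. -/
def vertices : UnitTriangle → Finset LatticePoint
  | (x, y, true) => {(x, y), (x + 1, y), (x, y + 1)}
  | (x, y, false) => {(x + 1, y), (x, y + 1), (x + 1, y + 1)}

/-- A lozenge is the union of two unit triangles that share a side (i.e. have exactly two common
vertices). -/
def IsLozenge (l : Finset UnitTriangle) : Prop :=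
  ∃ s ∈ l, ∃ t ∈ l, l = {s, t} ∧ (vertices s ∩ vertices t).card = 2

instance : DecidablePred IsLozenge := fun l => by unfold IsLozenge; infer_instance

/-- The lozenge tilings of a region `R` (a finite set of unit triangles): the sets of lozenges
contained in `R` such that every unit triangle of `R` lies in exactly one of them. -/
def tilings (R : Finset UnitTriangle) : Finset (Finset (Finset UnitTriangle)) :=
  {T ∈ {l ∈ R.powerset | IsLozenge l}.powerset | ∀ t ∈ R, {l ∈ T | t ∈ l}.card = 1}

theorem mem_tilings {R : Finset UnitTriangle} {T : Finset (Finset UnitTriangle)} :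
    T ∈ tilings R ↔ (∀ l ∈ T, l ⊆ R ∧ IsLozenge l) ∧ ∀ t ∈ R, ∃! l, l ∈ T ∧ t ∈ l := by
  simp only [tilings, Finset.mem_filter, Finset.mem_powerset, Finset.card_eq_one]
  refine and_congr ?_ (forall₂_congr fun t _ => exists_congr fun l => ?_)
  · simp [Finset.subset_iff (s₁ := T)]
  simp only [Finset.ext_iff (s₂ := {l}), Finset.mem_filter, Finset.mem_singleton]
  constructor
  · intro h
    exact ⟨(h l).2 rfl, fun m hm => (h m).1 hm⟩
  · rintro ⟨h1, h2⟩ m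
    exact ⟨fun hm => h2 m hm, fun hm => hm ▸ h1⟩

/-- The weighted tiling enumerator of `R` in which the tile positions in `W` have weight `1/2`:
a tiling has weight `1/2^k`, where `k` is the number of its lozenges that occupy positions
in `W`. -/
def weightedCount (R : Finset UnitTriangle) (W : Finset (Finset UnitTriangle)) : ℚ :=
  ∑ T ∈ tilings R, (1 / 2 : ℚ) ^ (T ∩ W).card

/-- The lattice points of the closed hexagon that is traversed counterclockwise from the origin by
`b` steps `h`, `a` steps `e`, `c` steps `f`, `b` steps `-h`, `a` steps `-e`, `c` steps `-f`. Its
vertices are `(0, 0)`, `(b, 0)`, `(b, a)` (the eastern one), `(b - c, a + c)`, `(-c, a + c)` (the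
northwestern one) and `(-c, c)`. -/
def InHexagon (a b c : ℕ) (p : LatticePoint) : Prop :=
  (-(c : ℤ) ≤ p.1 ∧ p.1 ≤ b) ∧ (0 ≤ p.2 ∧ p.2 ≤ a + c) ∧ (0 ≤ p.1 + p.2 ∧ p.1 + p.2 ≤ a + b)

instance (a b c : ℕ) : DecidablePred (InHexagon a b c) :=
  fun p => by unfold InHexagon; infer_instance

/-- The hexagon `H(a,b,c)`: all unit triangles with their vertices in the closed hexagon. The box
only serves to make the set finite, see `mem_hexagon`. -/
def hexagon (a b c : ℕ) : Finset UnitTriangle :=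
  {t ∈ Finset.Icc (-(c : ℤ)) b ×ˢ Finset.Icc (0 : ℤ) (a + c) ×ˢ (Finset.univ : Finset Bool) |
    ∀ p ∈ vertices t, InHexagon a b c p}

theorem mem_hexagon {a b c : ℕ} {t : UnitTriangle} :
    t ∈ hexagon a b c ↔ ∀ p ∈ vertices t, InHexagon a b c p := by
  unfold hexagon
  rw [Finset.mem_filter, Finset.mem_product, Finset.mem_product]
  refine and_iff_right_of_imp fun h => ?_
  obtain ⟨x, y, _ | _⟩ := t <;>
    simp only [vertices, InHexagon, Finset.mem_insert, Finset.mem_singleton, forall_eq_or_imp,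
      forall_eq] at h <;>
    refine ⟨Finset.mem_Icc.2 ?_, Finset.mem_Icc.2 ?_, Finset.mem_univ _⟩ <;>
    simp only [] <;> omega

/-- The lozenge (with sides parallel to `h` and `e`) that is reached from the northwestern corner
`(-c, a + c)` of `H(a,b,c)` by `i` steps `h` along the top side and `j` steps `-e`. The one for
`i = j = 0` sits in that corner. -/
def nwLozenge (a c : ℕ) (i j : ℕ) : Finset UnitTriangle :=
  {up (-c + i) (a + c - 1 - j), down (-c + i) (a + c - 1 - j)}

/-- The lozenge (with sides parallel to `e` and `f`) that is reached from the eastern corner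
`(b, a)` of `H(a,b,c)` by `i` steps `-e` along the southeastern side and `j` steps `f` along the
northeastern side. The one for `i = j = 0` sits in that corner. -/
def eastLozenge (a b : ℕ) (i j : ℕ) : Finset UnitTriangle :=
  {up (b - 1 - j) (a - i + j), down (b - 1 - j) (a - i + j - 1)}

/-- The maximal staircase of lozenges at a corner at which sides of lengths `m` and `n` meet has
rows of `k - 1, k - 2, …, 1` lozenges, where `k = min m n`. It consists of the positions `(i, j)`
with `i + j + 1 < k`. -/
def staircase (m n : ℕ) : Finset (ℕ × ℕ) :=
  {p ∈ Finset.range m ×ˢ Finset.range n | p.1 + p.2 + 1 < min m n}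

/-- The tile positions that fit in the indentations of the zig-zag cut along which the maximal
staircase was removed: the `k = min m n` positions `(i, j)` with `i + j + 1 = k`, next to it. -/
def indentations (m n : ℕ) : Finset (ℕ × ℕ) :=
  {p ∈ Finset.range m ×ˢ Finset.range n | p.1 + p.2 + 1 = min m n}

/-- The region `H_d(a,b,c)`: the hexagon `H(a,b,c)` with the maximal staircases removed from its
northwestern corner (where sides of lengths `b` and `a` meet) and its eastern corner (where sides
of lengths `a` and `c` meet). -/
def Hd (a b c : ℕ) : Finset UnitTriangle :=
  hexagon a b c \
    ((staircase b a).biUnion (fun p => nwLozenge a c p.1 p.2) ∪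
      (staircase a c).biUnion (fun p => eastLozenge a b p.1 p.2))

/-- The tile positions along the northwestern zig-zag cut. -/
def nwPositions (a b c : ℕ) : Finset (Finset UnitTriangle) :=
  (indentations b a).image (fun p => nwLozenge a c p.1 p.2)

/-- The tile positions along the eastern zig-zag cut. -/
def eastPositions (a b c : ℕ) : Finset (Finset UnitTriangle) :=
  (indentations a c).image (fun p => eastLozenge a b p.1 p.2)

/-- The weighted enumerator `L^*_*(H_d(a,b,c))`: the tile positions along both zig-zag cuts are
weighted by `1/2`. -/
def LStarStar (a b c : ℕ) : ℚ :=
  weightedCount (Hd a b c) (nwPositions a b c ∪ eastPositions a b c)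

/-- The shifted factorial `(α)_k = α (α + 1) ⋯ (α + k - 1)`, with `(α)_0 = 1`. -/
def shiftedFactorial (α : ℚ) (k : ℕ) : ℚ := (ascPochhammer ℚ k).eval α

end LozengeTiling

end

noncomputable section

namespace LozengeTiling

/-! The northwestern staircase is put back and then forced: in that corner the lozenges `{up (x + 1)
t, down x t}` get weight 0, so a tiling of nonzero weight contains the whole staircase
(`LStarStar_eq_wsum`). The eastern staircase stays removed; its cut bounds the region by the line `2
x + t = 2 b - 1`.

Peeling off horizontal rows from the top turns a tiling into `b` nonintersecting lattice paths. They
start at `0, …, b - 1` on the bottom and end at `-c, …, -c + b - 1` on the top. The product of the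
one-path weights is multilinear in the rows of a matrix, and families in which two paths meet
contribute determinants with equal rows. Hence the enumerator is a determinant of one-path counts
(`wsum_sweep`), a transfer form of the Lindström–Gessel–Viennot lemma. A vertical lozenge sits at
each position that no path uses. After the product of all vertical weights is taken out, which gives
`2^(-a)`, a path gains a factor 2 whenever it leaves the eastern line. Paths with this weight are
free paths folded along the line, so the reflection principle counts them by a sum of two binomials
(`reflectedPaths`). Behind the northwestern cut a path is frozen, and only its entry step matters
(`cutPaths_succ`).

Unitriangular column operations merge the two binomials by Vandermonde's convolution
(`sum_choose_mul_intChoose`). The remaining combination of two adjacent binomials has a linear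
factor that is constant along each row (`half_choose_add_choose`). This leaves `pochDet b c x` at `x
= a`.

For variable `x` this determinant follows from Dodgson condensation. Its entries depend on `i + j`
and `i - 2 j`, so the minors in the Desnanot-Jacobi identity belong to the same family
(`pochDet_condense`), and the product formula satisfies the same recurrence (`pochProd_condense`).
The inner minor must not vanish, which is clear for non-integral `x`; continuity in real `x` then
gives the integral values. -/

/-! ### The Desnanot-Jacobi identity -/

theorem det_submatrix_equiv_equiv {m n : Type*} [Fintype m] [DecidableEq m] [Fintype n]
    [DecidableEq n] {R : Type*} [CommRing R] (e f : m ≃ n) (M : Matrix n n R) :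
    (M.submatrix e f).det = Equiv.Perm.sign (f.trans e.symm) * M.det := by
  have : M.submatrix e f = (M.submatrix e e).submatrix id (f.trans e.symm) := by
    ext i j; simp
  rw [this, Matrix.det_permute', Matrix.det_submatrix_equiv_self]

/-- The rows or columns of a bordered matrix: the inner ones, then the first one. -/
def innerFirst (n : ℕ) : Fin n ⊕ Unit ≃ Fin (n + 1) where
  toFun := Sum.elim Fin.succ fun _ => 0
  invFun := Fin.cases (Sum.inr ()) Sum.inl
  left_inv := by rintro (i | i) <;> simp
  right_inv i := by induction i using Fin.cases <;> simp

/-- The rows or columns of a bordered matrix: the inner ones, then the last one. -/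
def innerLast (n : ℕ) : Fin n ⊕ Unit ≃ Fin (n + 1) where
  toFun := Sum.elim Fin.castSucc fun _ => Fin.last n
  invFun := Fin.lastCases (Sum.inr ()) Sum.inl
  left_inv := by rintro (i | i) <;> simp
  right_inv i := by induction i using Fin.lastCases <;> simp

/-- The rows or columns of a bordered matrix: the inner ones, then the first and the last one. -/
def innerFirstLast (n : ℕ) : Fin n ⊕ Fin 2 ≃ Fin (n + 2) where
  toFun := Sum.elim (fun i => i.castSucc.succ) ![0, Fin.last (n + 1)]
  invFun := Fin.cases (Sum.inr 0) (Fin.lastCases (Sum.inr 1) Sum.inl)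
  left_inv := by
    rintro (i | i)
    · simp
    · fin_cases i
      · simp
      · simp [← Fin.succ_last]
  right_inv i := by
    induction i using Fin.cases with
    | zero => simp
    | succ i =>
      induction i using Fin.lastCases with
      | last => simp [← Fin.succ_last]
      | cast i => simp

/-- The Desnanot-Jacobi identity, for matrices whose inner minor does not vanish. -/
theorem desnanot_jacobi {K : Type*} [Field K] {n : ℕ} (A : Matrix (Fin (n + 2)) (Fin (n + 2)) K)
    (h : (A.submatrix (fun i : Fin n => i.castSucc.succ) fun i : Fin n => i.castSucc.succ).det ≠ 0) :
    A.det * (A.submatrix (fun i : Fin n => i.castSucc.succ) fun i : Fin n => i.castSucc.succ).det =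
      (A.submatrix Fin.castSucc Fin.castSucc).det * (A.submatrix Fin.succ Fin.succ).det -
        (A.submatrix Fin.succ Fin.castSucc).det * (A.submatrix Fin.castSucc Fin.succ).det := by
  set M := A.submatrix (fun i : Fin n => i.castSucc.succ) fun i : Fin n => i.castSucc.succ with hM
  have : Invertible M := Matrix.invertibleOfIsUnitDet M (isUnit_iff_ne_zero.2 h)
  -- The Schur complement of the inner block `M`. Every minor in the identity is `M.det` times a
  -- minor of `S` of order 1 or 2, up to sign.
  let S : Fin (n + 2) → Fin (n + 2) → K := fun i j =>
    A i j - ∑ l, (∑ k, A i (Fin.succ (Fin.castSucc k)) * (⅟M) k l) * A (Fin.succ (Fin.castSucc l)) j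
  have minor (i j : Fin (n + 2)) :
      (Matrix.fromBlocks M (Matrix.of fun k (_ : Unit) => A k.castSucc.succ j)
        (Matrix.of fun (_ : Unit) k => A i k.castSucc.succ) (Matrix.of fun _ _ => A i j)).det =
      M.det * S i j := by
    rw [Matrix.det_fromBlocks₁₁, Matrix.det_unique (n := Unit)]
    simp [S, Matrix.mul_apply]
  have h00 : (A.submatrix Fin.castSucc Fin.castSucc).det = M.det * S 0 0 := by
    rw [← minor, ← Matrix.det_submatrix_equiv_self (innerFirst n)]
    congr 1
    ext (i | i) (j | j) <;> simp [innerFirst, hM]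
  have h11 : (A.submatrix Fin.succ Fin.succ).det =
      M.det * S (Fin.last _) (Fin.last _) := by
    rw [← minor, ← Matrix.det_submatrix_equiv_self (innerLast n)]
    congr 1
    ext (i | i) (j | j) <;> simp [innerLast, hM]
  have h10 : Equiv.Perm.sign ((innerFirst n).trans (innerLast n).symm) *
      (A.submatrix Fin.succ Fin.castSucc).det = M.det * S (Fin.last _) 0 := by
    rw [← minor, ← det_submatrix_equiv_equiv (innerLast n) (innerFirst n)]
    congr 1
    ext (i | i) (j | j) <;> simp [innerLast, innerFirst, hM]
  have h01 : Equiv.Perm.sign ((innerLast n).trans (innerFirst n).symm) *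
      (A.submatrix Fin.castSucc Fin.succ).det = M.det * S 0 (Fin.last _) := by
    rw [← minor, ← det_submatrix_equiv_equiv (innerFirst n) (innerLast n)]
    congr 1
    ext (i | i) (j | j) <;> simp [innerLast, innerFirst, hM]
  -- The two off-diagonal corner minors are reordered by mutually inverse permutations, so the signs
  -- cancel in their product.
  have hsign : ((Equiv.Perm.sign ((innerFirst n).trans (innerLast n).symm) : ℤ) : K) *
      (Equiv.Perm.sign ((innerLast n).trans (innerFirst n).symm) : ℤ) = 1 := by
    rw [← Int.cast_mul, ← Units.val_mul, ← Equiv.Perm.sign_mul]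
    have : (innerFirst n).trans (innerLast n).symm * (innerLast n).trans (innerFirst n).symm = 1 := by
      ext x; simp
    simp [this]
  have hA : A.det = M.det * (S 0 0 * S (Fin.last _) (Fin.last _) -
      S 0 (Fin.last _) * S (Fin.last _) 0) := by
    rw [← Matrix.det_submatrix_equiv_self (innerFirstLast n)]
    have : A.submatrix (innerFirstLast n) (innerFirstLast n) = Matrix.fromBlocks M
        (Matrix.of fun k j => A k.castSucc.succ (![0, Fin.last (n + 1)] j))
        (Matrix.of fun i k => A (![0, Fin.last (n + 1)] i) k.castSucc.succ)
        (Matrix.of fun i j => A (![0, Fin.last (n + 1)] i) (![0, Fin.last (n + 1)] j)) := by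
      ext (i | i) (j | j) <;> simp [innerFirstLast, hM]
    rw [this, Matrix.det_fromBlocks₁₁, Matrix.det_fin_two]
    simp [S, Matrix.mul_apply]
  rw [hA, h00, h11]
  linear_combination (-(A.submatrix Fin.succ Fin.castSucc).det *
      (A.submatrix Fin.castSucc Fin.succ).det) * hsign + M.det * S (Fin.last _) 0 * h01 +
      (Equiv.Perm.sign ((innerLast n).trans (innerFirst n).symm) : ℤ) *
      (A.submatrix Fin.castSucc Fin.succ).det * h10

/-! ### Evaluation of the determinant of rising factorials by condensation -/

open Finset

/-- The rising factorial `x (x + 1) ⋯ (x + n - 1)`. -/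
def rising {K : Type*} [CommRing K] (x : K) (n : ℕ) : K := ∏ i ∈ range n, (x + i)

theorem rising_zero {K : Type*} [CommRing K] (x : K) : rising x 0 = 1 := by simp [rising]

theorem rising_succ {K : Type*} [CommRing K] (x : K) (n : ℕ) :
    rising x (n + 1) = rising x n * (x + n) := by
  simp [rising, prod_range_succ]

theorem rising_succ' {K : Type*} [CommRing K] (x : K) (n : ℕ) :
    rising x (n + 1) = x * rising (x + 1) n := by
  rw [rising, prod_range_succ', rising, mul_comm]
  congr 1
  · simp
  · exact prod_congr rfl fun i _ => by push_cast; ring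

theorem rising_eq_ascPochhammer {K : Type*} [CommRing K] (x : K) (n : ℕ) :
    rising x n = (ascPochhammer K n).eval x := by
  induction n with
  | zero => simp [rising_zero]
  | succ n ih => rw [rising_succ, ascPochhammer_succ_eval, ih]

theorem rising_ne_zero {K : Type*} [Field K] {x : K} (hx : ∀ n : ℤ, x ≠ n) (n : ℕ) :
    rising x n ≠ 0 := by
  refine prod_ne_zero_iff.2 fun i _ h => hx (-i) ?_
  push_cast
  linear_combination h

/-- The determinant `det ((x + i - 2 j + 1)_{c + i + j} / (c + i + j + 1)!)` of size `b`. -/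
def pochDet {K : Type*} [Field K] (b c : ℕ) (x : K) : K :=
  (Matrix.of fun i j : Fin b =>
    rising (x + i - 2 * j + 1) (c + i + j) / ((c + i + j + 1)! : ℕ)).det

/-- The factor of `pochProd` that does not depend on `x`. -/
def factProd (b : ℕ) : ℕ := ∏ m ∈ range b, m !

/-- The denominator of `pochProd`. -/
def denomProd (b c : ℕ) : ℕ := ∏ m ∈ range b, (b + c + m)!

/-- The product of the factors of `pochProd` of length `c`. -/
def longProd {K : Type*} [CommRing K] (b c : ℕ) (x : K) : K :=
  ∏ m ∈ range b, rising (x - b + 2 + 2 * m) c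

/-- The product of rising factorials of lengths `b - 1, …, 0`. -/
def stairProd {K : Type*} [CommRing K] (b : ℕ) (z : K) : K :=
  ∏ m ∈ range b, rising (z + 3 * m + 2) (b - 1 - m)

/-- The product formula for `pochDet`. -/
def pochProd {K : Type*} [Field K] (b c : ℕ) (x : K) : K :=
  factProd b * longProd b c x * stairProd b (c - x) * stairProd b (x + 2 * c + 1) / denomProd b c

/-- This and the three other `_condense` lemmas for the constituents of `pochProd` record the linear
factors by which their products in the condensation recurrence differ. -/
theorem factProd_condense (b : ℕ) :
    factProd (b + 2) * factProd b = (b + 1) * (factProd (b + 1) * factProd (b + 1)) := by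
  simp only [factProd, prod_range_succ, Nat.factorial_succ]
  ring

theorem stairProd_succ {K : Type*} [CommRing K] (b : ℕ) (z : K) :
    stairProd (b + 1) z = stairProd b z * ∏ m ∈ range b, (z + b + 1 + 2 * m) := by
  rw [stairProd, prod_range_succ, stairProd, ← prod_mul_distrib]
  simp only [Nat.add_sub_cancel, Nat.sub_self, rising_zero, mul_one]
  refine prod_congr rfl fun m hm => ?_
  obtain ⟨k, rfl⟩ := Nat.exists_eq_add_of_lt (mem_range.1 hm)
  -- Passing from `b` to `b + 1` appends one last factor to each rising factorial: `(z + 3 m + 2) +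
  -- (b - 1 - m) = z + b + 1 + 2 m`.
  rw [show m + k + 1 - m = (m + k + 1 - 1 - m) + 1 by omega, rising_succ]
  rw [show m + k + 1 - 1 - m = k by omega]
  push_cast
  ring

/-- By `stairProd_succ`, the factors gained from `b + 1` to `b + 2` at `z` and from `b` to `b + 1`
at `z + 3` agree, except for the first one at `z`. -/
theorem stairProd_condense {K : Type*} [CommRing K] (b : ℕ) (z : K) :
    stairProd (b + 2) z * stairProd b (z + 3) =
      (z + b + 2) * (stairProd (b + 1) z * stairProd (b + 1) (z + 3)) := by
  rw [stairProd_succ (b + 1) z, stairProd_succ b (z + 3), prod_range_succ']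
  have : ∏ k ∈ range b, (z + ((b + 1 : ℕ) : K) + 1 + 2 * ((k + 1 : ℕ) : K)) =
      ∏ m ∈ range b, (z + 3 + b + 1 + 2 * (m : K)) :=
    prod_congr rfl fun i _ => by push_cast; ring
  rw [this]
  push_cast
  ring

theorem denomProd_condense (b c : ℕ) :
    denomProd (b + 2) c * denomProd b (c + 2) =
        (2 * b + c + 3) * (denomProd (b + 1) (c + 1) * denomProd (b + 1) (c + 1)) ∧
      denomProd (b + 2) c * denomProd b (c + 2) =
        (b + c + 2) * (denomProd (b + 1) c * denomProd (b + 1) (c + 2)) := by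
  have h1 : denomProd (b + 2) c =
      (∏ m ∈ range b, (b + c + 2 + m)!) * (2 * b + c + 2)! * (2 * b + c + 3)! := by
    rw [denomProd, prod_range_succ, prod_range_succ]
    congr 1
    · congr 1
      · exact prod_congr rfl fun m _ => by congr 1; ring
      · congr 1; ring
    · congr 1; ring
  have h2 : denomProd b (c + 2) = ∏ m ∈ range b, (b + c + 2 + m)! :=
    prod_congr rfl fun m _ => by congr 1
  have h3 : denomProd (b + 1) (c + 1) =
      (∏ m ∈ range b, (b + c + 2 + m)!) * (2 * b + c + 2)! := by
    rw [denomProd, prod_range_succ]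
    congr 1
    · exact prod_congr rfl fun m _ => by congr 1; ring
    · congr 1; ring
  have h4 : denomProd (b + 1) c = (∏ m ∈ range b, (b + c + 2 + m)!) * (b + c + 1)! := by
    rw [denomProd, prod_range_succ']
    congr 1
    · exact prod_congr rfl fun m _ => by congr 1; ring
    · congr 1; ring
  have h5 : (b + c + 2)! * denomProd (b + 1) (c + 2) =
      (∏ m ∈ range b, (b + c + 2 + m)!) * (2 * b + c + 2)! * (2 * b + c + 3)! := by
    rw [← h1, denomProd, denomProd, prod_range_succ' _ (b + 1), mul_comm]
    congr 1
    · exact prod_congr rfl fun m _ => by congr 1; ring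
    · congr 1; ring
  constructor
  · rw [h1, h2, h3, Nat.factorial_succ (2 * b + c + 2)]
    ring
  · rw [h1, h2, h4, ← h5, Nat.factorial_succ (b + c + 1)]
    ring

theorem longProd_condense {K : Type*} [CommRing K] (b c : ℕ) (x : K) :
    (x + c - b) * (x + b + 1) * (longProd (b + 2) c x * longProd b (c + 2) (x - 1)) =
        longProd (b + 1) c x * longProd (b + 1) (c + 2) (x - 1) ∧
      (x + c + b + 2) * (x - b - 1) * (longProd (b + 2) c x * longProd b (c + 2) (x - 1)) =
        longProd (b + 1) (c + 1) (x + 1) * longProd (b + 1) (c + 1) (x - 2) := by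
  -- In terms of `y = x - b` the bases of the rising factorials are `y` plus integers. All six
  -- products share the blocks `e`, `o` (even and odd bases) and `g`, `g'` (the factors by which
  -- lengths exceed `c`).
  obtain ⟨y, rfl⟩ : ∃ y, x = y + b := ⟨x - b, by ring⟩
  set e := ∏ m ∈ range b, rising (y + 2 + 2 * m) c with he
  set o := ∏ m ∈ range b, rising (y + 1 + 2 * m) c with ho
  set g := ∏ m ∈ range b, (y + c + 1 + 2 * m) with hg
  set g' := ∏ m ∈ range b, (y + c + 2 + 2 * m) with hg'
  have h1 : longProd (b + 2) c (y + b) = e * rising y c * rising (y + 2 * b + 2) c := by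
    rw [longProd, prod_range_succ, prod_range_succ']
    congr 1
    · congr 1
      · exact prod_congr rfl fun m _ => by congr 1; push_cast; ring
      · congr 1; push_cast; ring
    · congr 1; push_cast; ring
  have h2 : longProd b (c + 2) (y + b - 1) = o * g * g' := by
    rw [longProd, ho, hg, hg', ← prod_mul_distrib, ← prod_mul_distrib]
    refine prod_congr rfl fun m _ => ?_
    rw [rising_succ, rising_succ, show y + b - 1 - b + 2 + 2 * m = y + 1 + 2 * (m : K) by ring]
    push_cast
    ring
  have h3 : longProd (b + 1) c (y + b) = o * rising (y + 1 + 2 * b) c := by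
    rw [longProd, prod_range_succ]
    congr 1
    · exact prod_congr rfl fun m _ => by congr 1; push_cast; ring
    · congr 1; push_cast; ring
  have h4 : longProd (b + 1) (c + 2) (y + b - 1) =
      e * rising y c * (g' * (y + c)) * (g * (y + c + 1 + 2 * b)) := by
    have k1 : e * rising y c = ∏ m ∈ range (b + 1), rising (y + 2 * m) c := by
      rw [prod_range_succ']
      congr 1
      · exact prod_congr rfl fun m _ => by congr 1; push_cast; ring
      · congr 1; push_cast; ring
    have k2 : g' * (y + c) = ∏ m ∈ range (b + 1), (y + c + 2 * (m : K)) := by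
      rw [prod_range_succ']
      congr 1
      · exact prod_congr rfl fun m _ => by push_cast; ring
      · push_cast; ring
    have k3 : g * (y + c + 1 + 2 * b) = ∏ m ∈ range (b + 1), (y + c + 1 + 2 * (m : K)) := by
      rw [prod_range_succ]
    rw [k1, k2, k3, ← prod_mul_distrib, ← prod_mul_distrib, longProd]
    refine prod_congr rfl fun m _ => ?_
    rw [rising_succ, rising_succ,
      show y + b - 1 - ((b + 1 : ℕ) : K) + 2 + 2 * m = y + 2 * (m : K) by push_cast; ring]
    push_cast
    ring
  have h5 : longProd (b + 1) (c + 1) (y + b + 1) =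
      e * g' * (rising (y + 2 * b + 2) c * (y + 2 + 2 * b + c)) := by
    rw [longProd, prod_range_succ, rising_succ, he, hg', ← prod_mul_distrib]
    congr 1
    · refine prod_congr rfl fun m _ => ?_
      rw [rising_succ,
        show y + b + 1 - ((b + 1 : ℕ) : K) + 2 + 2 * m = y + 2 + 2 * (m : K) by push_cast; ring]
      ring
    · rw [show y + b + 1 - ((b + 1 : ℕ) : K) + 2 + 2 * b = y + 2 * b + 2 by push_cast; ring]
      ring
  have h6 : longProd (b + 1) (c + 1) (y + b - 2) = o * g * ((y - 1) * rising y c) := by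
    rw [longProd, prod_range_succ', rising_succ', ho, hg, ← prod_mul_distrib]
    congr 1
    · refine prod_congr rfl fun m _ => ?_
      rw [rising_succ, show y + b - 2 - ((b + 1 : ℕ) : K) + 2 + 2 * ((m + 1 : ℕ) : K) =
        y + 1 + 2 * (m : K) by push_cast; ring]
      ring
    · rw [show y + b - 2 - ((b + 1 : ℕ) : K) + 2 + 2 * ((0 : ℕ) : K) = y - 1 by push_cast; ring,
        show y - 1 + 1 = y by ring]
  have h7 : rising (y + 1 + 2 * b) c * (y + 1 + 2 * b + c) =
      (y + 1 + 2 * b) * rising (y + 2 * b + 2) c := by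
    rw [← rising_succ, rising_succ', show y + 1 + 2 * (b : K) + 1 = y + 2 * b + 2 by ring]
  rw [h1, h2, h3, h4, h5, h6]
  constructor
  · linear_combination (-e * rising y c * (g' * (y + c)) * g * o) * h7
  · ring

/-- With common factors divided out, what remains is the polynomial identity `(b + 1) (c - x + b +
2) (x + 2 c + b + 3) = (b + c + 2) (x + c - b) (x + b + 1) - (2 b + c + 3) (x + c + b + 2) (x - b -
1)`. -/
theorem pochProd_condense {K : Type*} [Field K] [CharZero K] (b c : ℕ) (x : K) :
    pochProd (b + 2) c x * pochProd b (c + 2) (x - 1) =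
      pochProd (b + 1) c x * pochProd (b + 1) (c + 2) (x - 1) -
        pochProd (b + 1) (c + 1) (x + 1) * pochProd (b + 1) (c + 1) (x - 2) := by
  have hA := congrArg (Nat.cast : ℕ → K) (factProd_condense b)
  have hQ1 := congrArg (Nat.cast : ℕ → K) (denomProd_condense b c).1
  have hQ2 := congrArg (Nat.cast : ℕ → K) (denomProd_condense b c).2
  have hP := longProd_condense b c x
  have hU := stairProd_condense b ((c : K) - x)
  have hV := stairProd_condense b (x + 2 * c + 1)
  have hd (n k : ℕ) : (denomProd n k : K) ≠ 0 :=
    Nat.cast_ne_zero.2 (prod_ne_zero_iff.2 fun i _ => Nat.factorial_ne_zero _)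
  have n1 : (2 * b + c + 3 : K) ≠ 0 := by exact_mod_cast (2 * b + c + 2).succ_ne_zero
  have n2 : (b + c + 2 : K) ≠ 0 := by exact_mod_cast (b + c + 1).succ_ne_zero
  have e1 : ((c + 2 : ℕ) : K) - (x - 1) = c - x + 3 := by push_cast; ring
  have e2 : x - 1 + 2 * ((c + 2 : ℕ) : K) + 1 = x + 2 * c + 1 + 3 := by push_cast; ring
  have e3 : ((c + 1 : ℕ) : K) - (x + 1) = c - x := by push_cast; ring
  have e4 : x + 1 + 2 * ((c + 1 : ℕ) : K) + 1 = x + 2 * c + 1 + 3 := by push_cast; ring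
  have e5 : ((c + 1 : ℕ) : K) - (x - 2) = c - x + 3 := by push_cast; ring
  have e6 : x - 2 + 2 * ((c + 1 : ℕ) : K) + 1 = x + 2 * c + 1 := by push_cast; ring
  simp only [pochProd, e1, e2, e3, e4, e5, e6]
  push_cast at hA hQ1 hQ2
  set A := (factProd (b + 1) : K)
  set u := stairProd (b + 1) ((c : K) - x)
  set u' := stairProd (b + 1) ((c : K) - x + 3)
  set v := stairProd (b + 1) (x + 2 * c + 1)
  set v' := stairProd (b + 1) (x + 2 * c + 1 + 3)
  set Q := (denomProd (b + 2) c : K) * denomProd b (c + 2) with hQ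
  set P := longProd (b + 2) c x * longProd b (c + 2) (x - 1) with hPdef
  have hQ0 : Q ≠ 0 := mul_ne_zero (hd _ _) (hd _ _)
  have l1 : (factProd (b + 2) : K) * longProd (b + 2) c x * stairProd (b + 2) ((c : K) - x) *
      stairProd (b + 2) (x + 2 * c + 1) / denomProd (b + 2) c *
      ((factProd b : K) * longProd b (c + 2) (x - 1) * stairProd b ((c : K) - x + 3) *
      stairProd b (x + 2 * c + 1 + 3) / denomProd b (c + 2)) =
      (b + 1) * (A * A) * P * ((c - x + b + 2) * (u * u')) *
        ((x + 2 * c + 1 + b + 2) * (v * v')) / Q := by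
    rw [div_mul_div_comm, ← hA, ← hU, ← hV, hPdef]
    congr 1
    ring
  have l2 : A * longProd (b + 1) c x * u * v / (denomProd (b + 1) c : K) *
      (A * longProd (b + 1) (c + 2) (x - 1) * u' * v' / (denomProd (b + 1) (c + 2) : K)) =
      (A * A) * ((x + c - b) * (x + b + 1) * P) * (u * u') * (v * v') / (Q / (b + c + 2)) := by
    rw [div_mul_div_comm, hQ2, hP.1, mul_div_cancel_left₀ _ n2]
    congr 1
    ring
  have l3 : A * longProd (b + 1) (c + 1) (x + 1) * u * v' / (denomProd (b + 1) (c + 1) : K) *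
      (A * longProd (b + 1) (c + 1) (x - 2) * u' * v / (denomProd (b + 1) (c + 1) : K)) =
      (A * A) * ((x + c + b + 2) * (x - b - 1) * P) * (u * u') * (v * v') /
        (Q / (2 * b + c + 3)) := by
    rw [div_mul_div_comm, hQ1, hP.2, mul_div_cancel_left₀ _ n1]
    congr 1
    ring
  rw [l1, l2, l3]
  clear_value P Q A u u' v v'
  field_simp
  ring

/-- Raising all row indices by one replaces `(c, x)` by `(c + 1, x + 1)`, raising all column indices
by `(c + 1, x - 2)`. -/
theorem pochDet_condense {K : Type*} [Field K] (b c : ℕ) (x : K)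
    (h : pochDet b (c + 2) (x - 1) ≠ 0) :
    pochDet (b + 2) c x * pochDet b (c + 2) (x - 1) =
      pochDet (b + 1) c x * pochDet (b + 1) (c + 2) (x - 1) -
        pochDet (b + 1) (c + 1) (x + 1) * pochDet (b + 1) (c + 1) (x - 2) := by
  have key : ∀ (n : ℕ) (f g : Fin n → Fin (b + 2)) (d : ℕ) (y : K),
      (∀ i j, c + (f i : ℕ) + g j = d + i + j) →
      (∀ i j, x + ((f i : ℕ) : K) - 2 * ((g j : ℕ) : K) = y + (i : ℕ) - 2 * (j : ℕ)) →
      ((Matrix.of fun i j : Fin (b + 2) =>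
        rising (x + i - 2 * j + 1) (c + i + j) / ((c + i + j + 1)! : ℕ)).submatrix f g).det =
        pochDet n d y := by
    intro n f g d y h1 h2
    rw [pochDet]
    congr 1
    ext i j
    simp only [Matrix.submatrix_apply, Matrix.of_apply, h1, h2]
  have k0 := key b (fun i => i.castSucc.succ) (fun i => i.castSucc.succ) (c + 2) (x - 1)
    (fun i j => by simp only [Fin.val_succ, Fin.val_castSucc]; ring)
    (fun i j => by simp only [Fin.val_succ, Fin.val_castSucc]; push_cast; ring)
  have k1 := key (b + 1) Fin.castSucc Fin.castSucc c x (fun i j => by simp) (fun i j => by simp)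
  have k2 := key (b + 1) Fin.succ Fin.succ (c + 2) (x - 1)
    (fun i j => by simp only [Fin.val_succ]; ring)
    (fun i j => by simp only [Fin.val_succ]; push_cast; ring)
  have k3 := key (b + 1) Fin.succ Fin.castSucc (c + 1) (x + 1)
    (fun i j => by simp only [Fin.val_succ, Fin.val_castSucc]; ring)
    (fun i j => by simp only [Fin.val_succ, Fin.val_castSucc]; push_cast; ring)
  have k4 := key (b + 1) Fin.castSucc Fin.succ (c + 1) (x - 2)
    (fun i j => by simp only [Fin.val_succ, Fin.val_castSucc]; ring)
    (fun i j => by simp only [Fin.val_succ, Fin.val_castSucc]; push_cast; ring)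
  have := desnanot_jacobi (Matrix.of fun i j : Fin (b + 2) =>
        rising (x + i - 2 * j + 1) (c + i + j) / ((c + i + j + 1)! : ℕ)) (by rwa [k0])
  rwa [k0, k1, k2, k3, k4] at this

/-- Every linear factor is `±x` plus an integer. -/
theorem pochProd_ne_zero {K : Type*} [Field K] [CharZero K] (b c : ℕ) {x : K}
    (hx : ∀ n : ℤ, x ≠ n) : pochProd b c x ≠ 0 := by
  have shift (y : K) (m : ℤ) (h : y = x + m ∨ y = m - x) : ∀ n : ℤ, y ≠ n := by
    rintro n rfl
    rcases h with h | h
    · exact hx (n - m) (by push_cast; linear_combination -h)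
    · exact hx (m - n) (by push_cast; linear_combination h)
  refine div_ne_zero (mul_ne_zero (mul_ne_zero (mul_ne_zero ?_ ?_) ?_) ?_) ?_
  · exact Nat.cast_ne_zero.2 (prod_ne_zero_iff.2 fun i _ => Nat.factorial_ne_zero _)
  · exact prod_ne_zero_iff.2 fun m _ => rising_ne_zero
      (shift _ (-b + 2 + 2 * m) (Or.inl (by push_cast; ring))) _
  · exact prod_ne_zero_iff.2 fun m _ => rising_ne_zero
      (shift _ (c + 3 * m + 2) (Or.inr (by push_cast; ring))) _
  · exact prod_ne_zero_iff.2 fun m _ => rising_ne_zero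
      (shift _ (2 * c + 1 + 3 * m + 2) (Or.inl (by push_cast; ring))) _
  · exact Nat.cast_ne_zero.2 (prod_ne_zero_iff.2 fun i _ => Nat.factorial_ne_zero _)

theorem pochDet_eq_pochProd_of_ne_intCast {K : Type*} [Field K] [CharZero K] (b : ℕ) :
    ∀ (c : ℕ) (x : K), (∀ n : ℤ, x ≠ n) → pochDet b c x = pochProd b c x := by
  induction b using Nat.strong_induction_on with
  | _ b ih =>
    intro c x hx
    match b with
    | 0 => simp [pochDet, pochProd, factProd, longProd, stairProd, denomProd]
    | 1 =>
      simp [pochDet, pochProd, factProd, longProd, stairProd, denomProd, rising_zero]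
      congr 2
      · ring
      · rw [add_comm]
    | b + 2 =>
      have shift (m : ℤ) : ∀ n : ℤ, x + m ≠ n := fun n h =>
        hx (n - m) (by push_cast; linear_combination h)
      have s1 : ∀ n : ℤ, x - 1 ≠ n := by simpa [sub_eq_add_neg] using shift (-1)
      have s2 : ∀ n : ℤ, x - 2 ≠ n := by simpa [sub_eq_add_neg] using shift (-2)
      have s3 : ∀ n : ℤ, x + 1 ≠ n := by simpa using shift 1
      have h0 := pochProd_ne_zero b (c + 2) s1
      have i0 := ih b (by omega) (c + 2) _ s1
      have := pochDet_condense b c x (by rwa [i0])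
      rw [i0, ih (b + 1) (by omega) _ _ hx, ih (b + 1) (by omega) _ _ s1, ih (b + 1) (by omega) _ _ s2,
        ih (b + 1) (by omega) _ _ s3, ← pochProd_condense] at this
      exact mul_right_cancel₀ h0 this

theorem continuous_rising {f : ℝ → ℝ} (hf : Continuous f) (n : ℕ) :
    Continuous fun x => rising (f x) n :=
  continuous_finsetProd _ fun _ _ => hf.add continuous_const

/-- The evaluation of `pochDet`. -/
theorem pochDet_eq_pochProd (b c : ℕ) (x : ℝ) : pochDet b c x = pochProd b c x := by
  have h1 : Continuous fun x : ℝ => pochDet b c x :=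
    Continuous.matrix_det (continuous_matrix fun i j =>
      (continuous_rising (by fun_prop) _).div_const _)
  have h2 : Continuous fun x : ℝ => pochProd b c x := by
    refine Continuous.div_const (((continuous_const.mul ?_).mul ?_).mul ?_) _ <;>
    exact continuous_finsetProd _ fun _ _ => continuous_rising (by fun_prop) _
  -- Irrational numbers serve as a dense set of non-integral points.
  refine congrFun (h1.ext_on dense_irrational h2 fun x hx => ?_) x
  exact pochDet_eq_pochProd_of_ne_intCast b c x fun n hn => hx ⟨n, by simp [hn]⟩

/-! ### Lozenges in coordinates and weighted tilings -/

/-- The sum over the lozenge tilings of `R` of the products of the weights of their lozenges. -/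
def wsum (R : Finset UnitTriangle) (w : Finset UnitTriangle → ℚ) : ℚ :=
  ∑ T ∈ tilings R, ∏ l ∈ T, w l

theorem weightedCount_eq_wsum (R : Finset UnitTriangle) (W : Finset (Finset UnitTriangle)) :
    weightedCount R W = wsum R fun l => if l ∈ W then 1 / 2 else 1 := by
  refine sum_congr rfl fun T _ => ?_
  rw [prod_ite, prod_const_one, mul_one, prod_const, filter_mem_eq_inter]

theorem up_ne_down (x y x' y' : ℤ) : up x y ≠ down x' y' := by simp [up, down]

theorem down_ne_up (x y x' y' : ℤ) : down x y ≠ up x' y' := by simp [up, down]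

theorem up_inj {x y x' y' : ℤ} : up x y = up x' y' ↔ x = x' ∧ y = y' := by simp [up]

theorem down_inj {x y x' y' : ℤ} : down x y = down x' y' ↔ x = x' ∧ y = y' := by simp [down]

theorem pair_inj {x y z t x' y' z' t' : ℤ} :
    ({up x y, down z t} : Finset UnitTriangle) = {up x' y', down z' t'} ↔
      (x = x' ∧ y = y') ∧ z = z' ∧ t = t' := by
  constructor
  · intro h
    have h1 : up x y ∈ ({up x' y', down z' t'} : Finset UnitTriangle) := by rw [← h]; simp
    have h2 : down z t ∈ ({up x' y', down z' t'} : Finset UnitTriangle) := by rw [← h]; simp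
    simpa [up_inj, down_inj, up_ne_down, down_ne_up] using And.intro h1 h2
  · rintro ⟨⟨rfl, rfl⟩, rfl, rfl⟩
    rfl

theorem exists_up_or_down (s : UnitTriangle) : ∃ x y, s = up x y ∨ s = down x y := by
  obtain ⟨x, y, _ | _⟩ := s
  · exact ⟨x, y, Or.inr rfl⟩
  · exact ⟨x, y, Or.inl rfl⟩

theorem card_vertices_up_inter_down {x y x' y' : ℤ} :
    (vertices (up x y) ∩ vertices (down x' y')).card = 2 ↔
      (x' = x ∧ y' = y) ∨ (x' = x - 1 ∧ y' = y) ∨ (x' = x ∧ y' = y - 1) := by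
  constructor
  · intro h
    obtain ⟨p, hp, q, hq, hpq⟩ := one_lt_card.1 (by rw [h]; norm_num :
      1 < (vertices (up x y) ∩ vertices (down x' y')).card)
    simp only [vertices, up, down, mem_inter, mem_insert, mem_singleton, Prod.ext_iff,
      Ne] at hp hq hpq
    omega
  · rintro (⟨rfl, rfl⟩ | ⟨rfl, rfl⟩ | ⟨rfl, rfl⟩)
    · have : vertices (up x' y') ∩ vertices (down x' y') = {(x' + 1, y'), (x', y' + 1)} := by
        ext ⟨p, q⟩
        simp only [vertices, up, down, mem_inter, mem_insert, mem_singleton, Prod.ext_iff]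
        omega
      rw [this, card_pair (by simp)]
    · have : vertices (up x y') ∩ vertices (down (x - 1) y') = {(x, y'), (x, y' + 1)} := by
        ext ⟨p, q⟩
        simp only [vertices, up, down, mem_inter, mem_insert, mem_singleton, Prod.ext_iff]
        omega
      rw [this, card_pair (by simp)]
    · have : vertices (up x' y) ∩ vertices (down x' (y - 1)) = {(x', y), (x' + 1, y)} := by
        ext ⟨p, q⟩
        simp only [vertices, up, down, mem_inter, mem_insert, mem_singleton, Prod.ext_iff]
        omega
      rw [this, card_pair (by simp)]

theorem card_vertices_up_inter_up (x y x' y' : ℤ) :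
    (vertices (up x y) ∩ vertices (up x' y')).card ≠ 2 := by
  intro h
  obtain ⟨p, hp, q, hq, hpq⟩ := one_lt_card.1 (by rw [h]; norm_num :
    1 < (vertices (up x y) ∩ vertices (up x' y')).card)
  simp only [vertices, up, mem_inter, mem_insert, mem_singleton, Prod.ext_iff, Ne] at hp hq hpq
  obtain ⟨rfl, rfl⟩ : x = x' ∧ y = y' := by omega
  rw [inter_self] at h
  have : (vertices (up x y)).card = 3 := card_eq_three.2
    ⟨(x, y), (x + 1, y), (x, y + 1), by simp, by simp, by simp, rfl⟩
  omega

theorem card_vertices_down_inter_down (x y x' y' : ℤ) :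
    (vertices (down x y) ∩ vertices (down x' y')).card ≠ 2 := by
  intro h
  obtain ⟨p, hp, q, hq, hpq⟩ := one_lt_card.1 (by rw [h]; norm_num :
    1 < (vertices (down x y) ∩ vertices (down x' y')).card)
  simp only [vertices, down, mem_inter, mem_insert, mem_singleton, Prod.ext_iff, Ne] at hp hq hpq
  obtain ⟨rfl, rfl⟩ : x = x' ∧ y = y' := by omega
  rw [inter_self] at h
  have : (vertices (down x y)).card = 3 := card_eq_three.2
    ⟨(x + 1, y), (x, y + 1), (x + 1, y + 1), by simp, by simp, by simp, rfl⟩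
  omega

theorem isLozenge_iff {l : Finset UnitTriangle} :
    IsLozenge l ↔ ∃ x y x' y', l = {up x y, down x' y'} ∧
      ((x' = x ∧ y' = y) ∨ (x' = x - 1 ∧ y' = y) ∨ (x' = x ∧ y' = y - 1)) := by
  constructor
  · rintro ⟨s, -, t, -, rfl, h⟩
    obtain ⟨x, y, rfl | rfl⟩ := exists_up_or_down s <;>
    obtain ⟨x', y', rfl | rfl⟩ := exists_up_or_down t
    · exact absurd h (card_vertices_up_inter_up _ _ _ _)
    · exact ⟨x, y, x', y', rfl, card_vertices_up_inter_down.1 h⟩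
    · rw [inter_comm] at h
      exact ⟨x', y', x, y, pair_comm _ _, card_vertices_up_inter_down.1 h⟩
    · exact absurd h (card_vertices_down_inter_down _ _ _ _)
  · rintro ⟨x, y, x', y', rfl, h⟩
    exact ⟨_, by simp, _, by simp, rfl, card_vertices_up_inter_down.2 h⟩

/-- The lozenges that contain a given upward pointing triangle. -/
theorem IsLozenge.eq_of_up_mem {l : Finset UnitTriangle} (hl : IsLozenge l) {x y : ℤ}
    (h : up x y ∈ l) :
    l = {up x y, down x y} ∨ l = {up x y, down (x - 1) y} ∨ l = {up x y, down x (y - 1)} := by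
  obtain ⟨x', y', x'', y'', rfl, h'⟩ := isLozenge_iff.1 hl
  simp only [mem_insert, mem_singleton, up_inj, up_ne_down, or_false] at h
  obtain ⟨rfl, rfl⟩ := h
  rcases h' with ⟨rfl, rfl⟩ | ⟨rfl, rfl⟩ | ⟨rfl, rfl⟩ <;> simp

/-- The lozenges that contain a given downward pointing triangle. -/
theorem IsLozenge.eq_of_down_mem {l : Finset UnitTriangle} (hl : IsLozenge l) {x y : ℤ}
    (h : down x y ∈ l) :
    l = {up x y, down x y} ∨ l = {up (x + 1) y, down x y} ∨ l = {up x (y + 1), down x y} := by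
  obtain ⟨x', y', x'', y'', rfl, h'⟩ := isLozenge_iff.1 hl
  simp only [mem_insert, mem_singleton, down_inj, down_ne_up, false_or] at h
  obtain ⟨rfl, rfl⟩ := h
  rcases h' with ⟨rfl, rfl⟩ | ⟨rfl, rfl⟩ | ⟨rfl, rfl⟩ <;> simp

theorem eq_of_mem_tiling {R : Finset UnitTriangle} {T : Finset (Finset UnitTriangle)}
    (hT : T ∈ tilings R) {l m : Finset UnitTriangle} (hl : l ∈ T) (hm : m ∈ T) {t : UnitTriangle}
    (htl : t ∈ l) (htm : t ∈ m) : l = m := by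
  obtain ⟨h1, h2⟩ := mem_tilings.1 hT
  exact (h2 t ((h1 l hl).1 htl)).unique ⟨hl, htl⟩ ⟨hm, htm⟩

/-- The tilings of `R` that contain a given set `B` of disjoint lozenges are the tilings of the
rest of `R`. -/
theorem sum_tilings_superset {R : Finset UnitTriangle} {B : Finset (Finset UnitTriangle)}
    (hB : ∀ l ∈ B, l ⊆ R ∧ IsLozenge l) (hd : ∀ l ∈ B, ∀ m ∈ B, ∀ t ∈ l, t ∈ m → l = m)
    (w : Finset UnitTriangle → ℚ) :
    ∑ T ∈ tilings R with B ⊆ T, ∏ l ∈ T, w l =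
      (∏ l ∈ B, w l) * wsum (R \ B.biUnion id) w := by
  have hnonempty (l : Finset UnitTriangle) (hl : IsLozenge l) : ∃ t, t ∈ l := by
    obtain ⟨s, hs, -⟩ := hl
    exact ⟨s, hs⟩
  have hdisj (T : Finset (Finset UnitTriangle)) (hT : T ∈ tilings (R \ B.biUnion id)) :
      Disjoint T B := by
    rw [disjoint_left]
    intro l hl hlB
    have := (mem_tilings.1 hT).1 l hl
    obtain ⟨t, ht⟩ := hnonempty l this.2
    exact (mem_sdiff.1 (this.1 ht)).2 (mem_biUnion.2 ⟨l, hlB, ht⟩)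
  rw [wsum, mul_sum]
  refine sum_bij' (fun T _ => T \ B) (fun T _ => T ∪ B) ?_ ?_ ?_ ?_ ?_
  · intro T hT
    obtain ⟨hT, hBT⟩ := mem_filter.1 hT
    have hT' := mem_tilings.1 hT
    refine mem_tilings.2 ⟨fun l hl => ?_, fun t ht => ?_⟩
    · obtain ⟨hl, hlB⟩ := mem_sdiff.1 hl
      refine ⟨fun t ht => mem_sdiff.2 ⟨(hT'.1 l hl).1 ht, fun h => ?_⟩, (hT'.1 l hl).2⟩
      obtain ⟨m, hm, htm⟩ := mem_biUnion.1 h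
      exact hlB (eq_of_mem_tiling hT hl (hBT hm) ht htm ▸ hm)
    · obtain ⟨htR, htB⟩ := mem_sdiff.1 ht
      obtain ⟨l, ⟨hl, htl⟩, hu⟩ := hT'.2 t htR
      refine ⟨l, ⟨mem_sdiff.2 ⟨hl, fun h => htB (mem_biUnion.2 ⟨l, h, htl⟩)⟩, htl⟩, ?_⟩
      rintro m ⟨hm, htm⟩
      exact hu m ⟨(mem_sdiff.1 hm).1, htm⟩
  · intro T hT
    have hT' := mem_tilings.1 hT
    refine mem_filter.2 ⟨mem_tilings.2 ⟨fun l hl => ?_, fun t ht => ?_⟩, subset_union_right⟩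
    · rcases mem_union.1 hl with hl | hl
      · exact ⟨(hT'.1 l hl).1.trans sdiff_subset, (hT'.1 l hl).2⟩
      · exact hB l hl
    · by_cases h : t ∈ B.biUnion id
      · obtain ⟨l, hl, htl⟩ := mem_biUnion.1 h
        refine ⟨l, ⟨mem_union_right _ hl, htl⟩, ?_⟩
        rintro m ⟨hm, htm⟩
        rcases mem_union.1 hm with hm | hm
        · exact absurd h (mem_sdiff.1 ((hT'.1 m hm).1 htm)).2
        · exact hd m hm l hl t htm htl
      · obtain ⟨l, ⟨hl, htl⟩, hu⟩ := hT'.2 t (mem_sdiff.2 ⟨ht, h⟩)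
        refine ⟨l, ⟨mem_union_left _ hl, htl⟩, ?_⟩
        rintro m ⟨hm, htm⟩
        rcases mem_union.1 hm with hm | hm
        · exact hu m ⟨hm, htm⟩
        · exact absurd (mem_biUnion.2 ⟨m, hm, htm⟩) h
  · intro T hT
    exact sdiff_union_of_subset (mem_filter.1 hT).2
  · intro T hT
    exact union_sdiff_cancel_right (hdisj T hT)
  · intro T hT
    rw [mul_comm, prod_sdiff (mem_filter.1 hT).2]

/-! ### From tilings to a determinant, row by row -/

/-- The part below the height `t` of the region with the upward pointing triangles `up x s`,
`x ∈ X s`, and the downward pointing triangles `down x (s - 1)`, `x ∈ X s`; from the highest row of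
downward pointing triangles only those in `S` are kept. -/
def sweep (X : ℤ → Finset ℤ) (t : ℕ) (S : Finset ℤ) : Finset UnitTriangle :=
  (Ico (0 : ℤ) t).biUnion fun s =>
    (X s).image (fun x => up x s) ∪ (if s + 1 = t then S else X (s + 1)).image fun x => down x s

theorem up_mem_sweep {X : ℤ → Finset ℤ} {t : ℕ} {S : Finset ℤ} {x s : ℤ} :
    up x s ∈ sweep X t S ↔ 0 ≤ s ∧ s < t ∧ x ∈ X s := by
  simp only [sweep, mem_biUnion, mem_Ico, mem_union, mem_image, up_inj, down_ne_up, and_false,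
    exists_false, or_false]
  constructor
  · rintro ⟨s', ⟨h1, h2⟩, x', hx, rfl, rfl⟩
    exact ⟨h1, h2, hx⟩
  · rintro ⟨h1, h2, hx⟩
    exact ⟨s, ⟨h1, h2⟩, x, hx, rfl, rfl⟩

theorem down_mem_sweep {X : ℤ → Finset ℤ} {t : ℕ} {S : Finset ℤ} {x s : ℤ} :
    down x s ∈ sweep X t S ↔
      0 ≤ s ∧ ((s + 1 < t ∧ x ∈ X (s + 1)) ∨ (s + 1 = t ∧ x ∈ S)) := by
  simp only [sweep, mem_biUnion, mem_Ico, mem_union, mem_image, down_inj, up_ne_down, and_false,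
    exists_false, false_or]
  constructor
  · rintro ⟨s', ⟨h1, h2⟩, x', hx, rfl, rfl⟩
    split_ifs at hx with h
    · exact ⟨h1, Or.inr ⟨h, hx⟩⟩
    · exact ⟨h1, Or.inl ⟨by omega, hx⟩⟩
  · rintro ⟨h1, ⟨h2, hx⟩ | ⟨h2, hx⟩⟩
    · exact ⟨s, ⟨h1, by omega⟩, x, by rwa [if_neg (by omega)], rfl, rfl⟩
    · exact ⟨s, ⟨h1, by omega⟩, x, by rwa [if_pos h2], rfl, rfl⟩

/-- The lozenges with an upward pointing triangle in row `t`, when the downward pointing triangles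
`y j` of this row are covered together with the upward pointing triangles `z j`. -/
def rowLozenges (X : ℤ → Finset ℤ) (t : ℤ) {n : ℕ} (y z : Fin n → ℤ) :
    Finset (Finset UnitTriangle) :=
  univ.image (fun j => {up (z j) t, down (y j) t}) ∪
    (X t \ univ.image z).image fun x => {up x t, down x (t - 1)}

theorem mem_rowLozenges {X : ℤ → Finset ℤ} {t : ℤ} {n : ℕ} {y z : Fin n → ℤ}
    {l : Finset UnitTriangle} : l ∈ rowLozenges X t y z ↔
      (∃ j, l = {up (z j) t, down (y j) t}) ∨
        ∃ x ∈ X t, (∀ j, z j ≠ x) ∧ l = {up x t, down x (t - 1)} := by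
  simp only [rowLozenges, mem_union, mem_image, mem_univ, true_and, mem_sdiff, not_exists, and_assoc,
    eq_comm (b := l)]

theorem prod_rowLozenges {X : ℤ → Finset ℤ} {t : ℤ} {n : ℕ} {y z : Fin n → ℤ}
    (hy : Function.Injective y) (w : Finset UnitTriangle → ℚ) :
    ∏ l ∈ rowLozenges X t y z, w l = (∏ j, w {up (z j) t, down (y j) t}) *
      ∏ x ∈ X t \ univ.image z, w {up x t, down x (t - 1)} := by
  rw [rowLozenges, prod_union, prod_image, prod_image]
  · intro x _ x' _ h
    exact (pair_inj.1 h).1.1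
  · intro j _ j' _ h
    exact hy (pair_inj.1 h).2.1
  · rw [disjoint_left]
    intro l hl hl'
    obtain ⟨j, -, rfl⟩ := mem_image.1 hl
    obtain ⟨x, -, hx⟩ := mem_image.1 hl'
    have := (pair_inj.1 hx).2.2
    omega

/-- The vertical lozenges use up the downward triangles of row `t - 1` below the positions outside
`z`. Those below `z` survive, so the paths go on from `z`. -/
theorem sweep_sdiff_rowLozenges (X : ℤ → Finset ℤ) (t : ℕ) {n : ℕ} (y z : Fin n → ℤ)
    (hz : ∀ j, z j ∈ X t) :
    sweep X (t + 1) (univ.image y) \ (rowLozenges X t y z).biUnion id =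
      sweep X t (univ.image z) := by
  ext s
  simp only [mem_sdiff, mem_biUnion, id, not_exists, not_and, mem_rowLozenges]
  obtain ⟨x, s, rfl | rfl⟩ := exists_up_or_down s
  · rw [up_mem_sweep, up_mem_sweep]
    constructor
    · rintro ⟨⟨h1, h2, h3⟩, h4⟩
      refine ⟨h1, lt_of_le_of_ne (by push_cast at h2; omega) ?_, h3⟩
      rintro rfl
      by_cases h : ∃ j, z j = x
      · obtain ⟨j, rfl⟩ := h
        exact h4 _ (Or.inl ⟨j, rfl⟩) (by simp)
      · exact h4 _ (Or.inr ⟨x, h3, not_exists.1 h, rfl⟩) (by simp)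
    · rintro ⟨h1, h2, h3⟩
      refine ⟨⟨h1, by push_cast; omega, h3⟩, ?_⟩
      rintro l (⟨j, rfl⟩ | ⟨x', -, -, rfl⟩) h <;>
      · simp only [mem_insert, mem_singleton, up_inj, up_ne_down, or_false] at h
        omega
  · rw [down_mem_sweep, down_mem_sweep]
    simp only [mem_image, mem_univ, true_and]
    push_cast
    constructor
    · rintro ⟨⟨h1, ⟨h2, h3⟩ | ⟨h2, j, rfl⟩⟩, h4⟩
      · rcases (by omega : s + 1 < t ∨ s + 1 = t) with h | h
        · exact ⟨h1, Or.inl ⟨h, h3⟩⟩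
        · refine ⟨h1, Or.inr ⟨h, ?_⟩⟩
          by_contra hx
          refine h4 _ (Or.inr ⟨x, h ▸ h3, not_exists.1 hx, rfl⟩) ?_
          simp [← h]
      · refine absurd ?_ (h4 _ (Or.inl ⟨j, rfl⟩))
        simp [down_inj]
        omega
    · rintro ⟨h1, ⟨h2, h3⟩ | ⟨h2, j, rfl⟩⟩
      · refine ⟨⟨h1, Or.inl ⟨by omega, h3⟩⟩, ?_⟩
        rintro l (⟨j, rfl⟩ | ⟨x', -, -, rfl⟩) h <;>
        · simp only [mem_insert, mem_singleton, down_inj, down_ne_up, false_or] at h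
          omega
      · refine ⟨⟨h1, Or.inl ⟨by omega, h2 ▸ hz j⟩⟩, ?_⟩
        rintro l (⟨j, rfl⟩ | ⟨x', -, hx', rfl⟩) h <;>
          simp only [mem_insert, mem_singleton, down_inj, down_ne_up, false_or] at h
        · omega
        · exact hx' j h.1

theorem rowLozenges_subset {X : ℤ → Finset ℤ} {t : ℕ} {n : ℕ} {y z : Fin n → ℤ}
    (hyz : ∀ j, z j = y j ∨ z j = y j + 1) (hz : ∀ j, z j ∈ X t)
    (h0 : t = 0 → X 0 ⊆ univ.image z) :
    ∀ l ∈ rowLozenges X t y z, l ⊆ sweep X (t + 1) (univ.image y) ∧ IsLozenge l := by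
  intro l hl
  rcases mem_rowLozenges.1 hl with ⟨j, rfl⟩ | ⟨x, hx, hxz, rfl⟩
  · refine ⟨?_, isLozenge_iff.2 ⟨_, _, _, _, rfl, by have := hyz j; omega⟩⟩
    simp only [insert_subset_iff, singleton_subset_iff, up_mem_sweep, down_mem_sweep]
    push_cast
    exact ⟨⟨by omega, by omega, hz j⟩, by omega, Or.inr ⟨rfl, mem_image_of_mem _ (mem_univ j)⟩⟩
  · have ht : t ≠ 0 := by
      intro ht
      have := h0 ht (by simpa [ht] using hx)
      obtain ⟨j, -, hj⟩ := mem_image.1 this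
      exact hxz j hj
    refine ⟨?_, isLozenge_iff.2 ⟨_, _, _, _, rfl, by omega⟩⟩
    simp only [insert_subset_iff, singleton_subset_iff, up_mem_sweep, down_mem_sweep]
    push_cast
    exact ⟨⟨by omega, by omega, hx⟩, by omega, Or.inl ⟨by omega, by simpa using hx⟩⟩

theorem rowLozenges_disjoint {X : ℤ → Finset ℤ} {t : ℤ} {n : ℕ} {y z : Fin n → ℤ}
    (hy : Function.Injective y) (hz : Function.Injective z) :
    ∀ l ∈ rowLozenges X t y z, ∀ m ∈ rowLozenges X t y z, ∀ s ∈ l, s ∈ m → l = m := by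
  intro l hl m hm s hsl hsm
  rcases mem_rowLozenges.1 hl with ⟨j, rfl⟩ | ⟨x, hx, hxz, rfl⟩ <;>
  rcases mem_rowLozenges.1 hm with ⟨k, rfl⟩ | ⟨x', hx', hxz', rfl⟩ <;>
  simp only [mem_insert, mem_singleton] at hsl hsm <;>
  rcases hsl with rfl | rfl <;>
  simp only [up_inj, down_inj, up_ne_down, down_ne_up, or_false, false_or, and_true] at hsm
  · rw [hz hsm]
  · rw [hy hsm]
  · exact absurd hsm (hxz' j)
  · omega
  · exact absurd hsm.symm (hxz k)
  · omega
  · rw [hsm]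
  · rw [hsm]

/-- Every coordinate of `y` is moved to the right by at most `1`. -/
def shift {n : ℕ} (y : Fin n → ℤ) (ε : Fin n → Bool) (j : Fin n) : ℤ := y j + (ε j).toNat

theorem shift_eq_or {n : ℕ} (y : Fin n → ℤ) (ε : Fin n → Bool) (j : Fin n) :
    shift y ε j = y j ∨ shift y ε j = y j + 1 := by
  rw [shift]
  cases ε j <;> simp

theorem shift_injective {n : ℕ} {y : Fin n → ℤ} {ε δ : Fin n → Bool} (h : shift y ε = shift y δ) :
    ε = δ := by
  ext j
  have := congrFun h j
  simp only [shift] at this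
  cases h1 : ε j <;> cases h2 : δ j <;> simp_all

theorem shift_monotone {n : ℕ} {y : Fin n → ℤ} (hy : StrictMono y) (ε : Fin n → Bool) :
    Monotone (shift y ε) := by
  intro j k hjk
  rcases hjk.eq_or_lt with rfl | h
  · exact le_rfl
  · have := hy h
    have := shift_eq_or y ε j
    have := shift_eq_or y ε k
    omega

/-- A downward triangle of the top row has no partner above it in the region, so it is paired with
its left or right neighbour. The other upward triangles of that row can then only be paired
downwards. -/
theorem existsUnique_shift {X : ℤ → Finset ℤ} {t n : ℕ} {y : Fin n → ℤ} (hy : StrictMono y)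
    {T : Finset (Finset UnitTriangle)} (hT : T ∈ tilings (sweep X (t + 1) (univ.image y))) :
    ∃! ε : Fin n → Bool, (StrictMono (shift y ε) ∧ ∀ j, shift y ε j ∈ X t) ∧
      rowLozenges X t y (shift y ε) ⊆ T := by
  obtain ⟨h1, h2⟩ := mem_tilings.1 hT
  have tile (j : Fin n) : ∃ e : Bool, {up (y j + e.toNat) t, down (y j) t} ∈ T := by
    obtain ⟨l, ⟨hl, hjl⟩, -⟩ := h2 (down (y j) t) (down_mem_sweep.2
      ⟨by omega, Or.inr ⟨by push_cast; rfl, mem_image_of_mem _ (mem_univ j)⟩⟩)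
    obtain ⟨hlR, hll⟩ := h1 l hl
    rcases hll.eq_of_down_mem hjl with rfl | rfl | rfl
    · exact ⟨false, by simpa using hl⟩
    · exact ⟨true, by simpa using hl⟩
    · have := up_mem_sweep.1 (hlR (mem_insert_self _ _))
      push_cast at this
      omega
  choose ε hε using tile
  have hε' (j : Fin n) : {up (shift y ε j) t, down (y j) t} ∈ T := hε j
  have hinj : Function.Injective (shift y ε) := by
    intro j k hjk
    have := eq_of_mem_tiling hT (hε' j) (hε' k) (t := up (shift y ε j) t) (by simp)
      (by simp [hjk])
    exact hy.injective (pair_inj.1 this).2.1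
  refine ⟨ε, ⟨⟨(shift_monotone hy ε).strictMono_of_injective hinj, fun j => ?_⟩, fun l hl => ?_⟩, ?_⟩
  · exact (up_mem_sweep.1 ((h1 _ (hε' j)).1 (mem_insert_self _ _))).2.2
  · rcases mem_rowLozenges.1 hl with ⟨j, rfl⟩ | ⟨x, hx, hxz, rfl⟩
    · exact hε' j
    · obtain ⟨l, ⟨hl, hxl⟩, -⟩ := h2 (up x t) (up_mem_sweep.2
        ⟨by omega, by push_cast; omega, hx⟩)
      obtain ⟨hlR, hll⟩ := h1 l hl
      have excl (x' : ℤ) (h : l = {up x t, down x' t}) : False := by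
        have hd : down x' t ∈ l := by simp [h]
        have := (down_mem_sweep.1 (hlR hd)).2
        push_cast at this
        rcases this with h' | ⟨-, h'⟩
        · omega
        · obtain ⟨j, -, rfl⟩ := mem_image.1 h'
          have := eq_of_mem_tiling hT (hε' j) hl (by simp) hd
          rw [h] at this
          exact hxz j (pair_inj.1 this).1.1
      rcases hll.eq_of_up_mem hxl with h | h | h
      · exact (excl _ h).elim
      · exact (excl _ h).elim
      · rwa [h] at hl
  · rintro δ ⟨-, hδ⟩
    refine shift_injective (y := y) (funext fun j => ?_)
    have := eq_of_mem_tiling hT (hδ (mem_rowLozenges.2 (Or.inl ⟨j, rfl⟩))) (hε' j)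
      (t := down (y j) t) (by simp) (by simp)
    exact (pair_inj.1 this).1.1

open Classical in
/-- The row with the number `t` of the tilings of the region below the height `t + 1`. -/
theorem wsum_sweep_succ {X : ℤ → Finset ℤ} {t n : ℕ} {y : Fin n → ℤ} (hy : StrictMono y)
    (h0 : (X 0).card = n) (w : Finset UnitTriangle → ℚ) :
    wsum (sweep X (t + 1) (univ.image y)) w = ∑ ε : Fin n → Bool,
      if StrictMono (shift y ε) ∧ ∀ j, shift y ε j ∈ X t then
        (∏ j, w {up (shift y ε j) t, down (y j) t}) *
          (∏ x ∈ X t \ univ.image (shift y ε), w {up x t, down x (t - 1)}) *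
          wsum (sweep X t (univ.image (shift y ε))) w
      else 0 := by
  have key (T : Finset (Finset UnitTriangle))
      (hT : T ∈ tilings (sweep X (t + 1) (univ.image y))) :
      ∏ l ∈ T, w l = ∑ ε : Fin n → Bool,
        if StrictMono (shift y ε) ∧ ∀ j, shift y ε j ∈ X t then
          if rowLozenges X t y (shift y ε) ⊆ T then ∏ l ∈ T, w l else 0 else 0 := by
    obtain ⟨ε, hε, hu⟩ := existsUnique_shift hy hT
    rw [sum_eq_single ε]
    · rw [if_pos hε.1, if_pos hε.2]
    · intro δ _ hδ
      split_ifs with h1 h2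
      · exact absurd (hu δ ⟨h1, h2⟩) hδ
      · rfl
      · rfl
    · simp
  rw [wsum, sum_congr rfl key, sum_comm]
  refine sum_congr rfl fun ε _ => ?_
  split_ifs with h
  · rw [← sum_filter, sum_tilings_superset, prod_rowLozenges hy.injective,
      sweep_sdiff_rowLozenges X t y _ h.2]
    · refine rowLozenges_subset (shift_eq_or y ε) h.2 ?_
      -- Nothing lies below row 0, so all its upward triangles must be on paths; `n` distinct
      -- positions in a set of size `n` fill it.
      rintro rfl
      refine (eq_of_subset_of_card_le (image_subset_iff.2 fun j _ => by simpa using h.2 j) ?_).ge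
      rw [card_image_of_injective _ h.1.injective, h0, card_fin]
    · exact rowLozenges_disjoint hy.injective h.1.injective
  · simp

theorem det_sum_rows {n : ℕ} (c : Fin n → Bool → ℚ) (M : Fin n → Bool → Fin n → ℚ) :
    (Matrix.of fun j k => ∑ e, c j e * M j e k).det =
      ∑ ε : Fin n → Bool, (∏ j, c j (ε j)) * (Matrix.of fun j k => M j (ε j) k).det := by
  have h1 : (Matrix.of fun j k => ∑ e, c j e * M j e k) = fun j => ∑ e, c j e • M j e := by
    ext j k
    simp only [Matrix.of_apply, Finset.sum_apply, Pi.smul_apply, smul_eq_mul]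
  rw [h1]
  exact ((Matrix.detRowAlternating (n := Fin n) (R := ℚ)).toMultilinearMap.map_sum _).trans
    (sum_congr rfl fun ε _ => MultilinearMap.map_smul_univ _ _ _)

/-- The weighted tiling enumerator of the region below the height `t` as a determinant of weighted
enumerators of single lattice paths. -/
theorem wsum_sweep {X : ℤ → Finset ℤ} {n N : ℕ} {w : Finset UnitTriangle → ℚ}
    (hw : ∀ t x : ℤ, w {up x t, down x (t - 1)} ≠ 0) (h0 : (X 0).card = n)
    (G : ℤ → Fin n → ℤ → ℚ)
    (hbase : ∀ y : Fin n → ℤ, StrictMono y → (∀ j, y j ∈ X 0) →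
      (Matrix.of fun j k => G 0 k (y j)).det = 1)
    (hstep : ∀ t : ℕ, t < N → ∀ k, ∀ y ∈ X (t + 1), G (t + 1) k y = ∑ e : Bool,
      (if y + e.toNat ∈ X t then w {up (y + e.toNat) t, down y t} /
        w {up (y + e.toNat) t, down (y + e.toNat) (t - 1)} else 0) * G t k (y + e.toNat)) :
    ∀ t : ℕ, t ≤ N → ∀ y : Fin n → ℤ, StrictMono y → (∀ j, y j ∈ X t) →
      wsum (sweep X t (univ.image y)) w =
        (∏ s ∈ range t, ∏ x ∈ X s, w {up x s, down x (s - 1)}) *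
          (Matrix.of fun j k => G t k (y j)).det := by
  intro t
  induction t with
  | zero =>
    intro _ y hy hyX
    have : sweep X 0 (univ.image y) = ∅ := by simp [sweep]
    have h : tilings ∅ = {∅} := by
      ext T
      rw [mem_tilings, mem_singleton]
      constructor
      · rintro ⟨h, -⟩
        refine eq_empty_of_forall_notMem fun l hl => ?_
        obtain ⟨hl', s, hs, -⟩ := h l hl
        exact absurd (hl' hs) (notMem_empty s)
      · rintro rfl
        simp
    rw [this, wsum, h]
    simpa using (hbase y hy (by simpa using hyX)).symm
  | succ t ih =>
    intro ht y hy hyX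
    have hdet : (Matrix.of fun j k => G ((t + 1 : ℕ) : ℤ) k (y j)).det =
        (Matrix.of fun j k => ∑ e : Bool,
          (if y j + e.toNat ∈ X t then w {up (y j + e.toNat) t, down (y j) t} /
            w {up (y j + e.toNat) t, down (y j + e.toNat) (t - 1)} else 0) *
              G t k (y j + e.toNat)).det := by
      congr 1
      ext j k
      rw [Matrix.of_apply, Matrix.of_apply]
      push_cast
      exact hstep t (by omega) k (y j) (by simpa using hyX j)
    rw [wsum_sweep_succ hy h0, hdet,
      det_sum_rows _ fun (j : Fin n) (e : Bool) (k : Fin n) => G t k (y j + e.toNat), mul_sum]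
    refine sum_congr rfl fun ε _ => ?_
    change _ = _ * ((∏ j, if shift y ε j ∈ X t then w {up (shift y ε j) t, down (y j) t} /
            w {up (shift y ε j) t, down (shift y ε j) (t - 1)} else 0) *
              (Matrix.of fun j k => G t k (shift y ε j)).det)
    split_ifs with h
    · rw [ih (by omega) _ h.1 h.2, prod_range_succ, prod_congr rfl fun j _ => if_pos (h.2 j),
        prod_div_distrib, ← prod_sdiff (image_subset_iff.2 fun j _ => h.2 j :
          univ.image (shift y ε) ⊆ X t), prod_image fun j _ k _ hjk => h.1.injective hjk]
      have : ∏ j, w {up (shift y ε j) t, down (shift y ε j) (t - 1)} ≠ 0 :=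
        prod_ne_zero_iff.2 fun j _ => hw _ _
      field_simp
    · rw [eq_comm]
      -- Inadmissible moves contribute 0: if two coordinates coincide, the determinant has equal
      -- rows; if one leaves the level, its coefficient is 0.
      by_cases hX : ∀ j, shift y ε j ∈ X t
      · have hinj : ¬ Function.Injective (shift y ε) := fun hinj =>
          h ⟨(shift_monotone hy ε).strictMono_of_injective hinj, hX⟩
        simp only [Function.Injective, not_forall] at hinj
        obtain ⟨j, k, hjk, hne⟩ := hinj
        rw [Matrix.det_zero_of_row_eq hne, mul_zero, mul_zero]
        ext i
        simp [hjk]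
      · obtain ⟨j, hj⟩ := not_forall.1 hX
        rw [prod_eq_zero (mem_univ j) (if_neg hj), zero_mul, mul_zero]

/-! ### The region, its zig-zag cuts and the forced staircase -/

/-- The abscissae of the upward pointing triangles in row `t` of the region that arises from
`H(a,b,c)` by removing the eastern staircase only. -/
def eastCutLevel (a b c : ℕ) (t : ℤ) : Finset ℤ :=
  {x ∈ Icc (-(c : ℤ)) b | 0 ≤ x + t ∧ x + t ≤ a + b - 1 ∧ 2 * x + t ≤ 2 * b - 1}

theorem mem_eastCutLevel {a b c : ℕ} {t x : ℤ} (ht : 0 ≤ t) : x ∈ eastCutLevel a b c t ↔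
    -(c : ℤ) ≤ x ∧ 0 ≤ x + t ∧ x + t ≤ a + b - 1 ∧ 2 * x + t ≤ 2 * b - 1 := by
  simp only [eastCutLevel, mem_filter, mem_Icc]
  omega

/-- The region that arises from `H(a,b,c)` by removing the eastern staircase only. -/
def eastCut (a b c : ℕ) : Finset UnitTriangle :=
  sweep (eastCutLevel a b c) (a + c) (eastCutLevel a b c (a + c))

theorem up_mem_eastCut {a b c : ℕ} {x t : ℤ} : up x t ∈ eastCut a b c ↔
    0 ≤ t ∧ t ≤ a + c - 1 ∧ -(c : ℤ) ≤ x ∧ 0 ≤ x + t ∧ x + t ≤ a + b - 1 ∧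
      2 * x + t ≤ 2 * b - 1 := by
  rw [eastCut, up_mem_sweep]
  push_cast
  constructor
  · rintro ⟨h1, h2, h3⟩
    rw [mem_eastCutLevel h1] at h3
    omega
  · rintro ⟨h1, h2, h3⟩
    rw [mem_eastCutLevel h1]
    omega

theorem down_mem_eastCut {a b c : ℕ} {x t : ℤ} : down x t ∈ eastCut a b c ↔
    0 ≤ t ∧ t ≤ a + c - 1 ∧ -(c : ℤ) ≤ x ∧ -1 ≤ x + t ∧ x + t ≤ a + b - 2 ∧
      2 * x + t ≤ 2 * b - 2 := by
  rw [eastCut, down_mem_sweep]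
  push_cast
  constructor
  · rintro ⟨h1, ⟨h2, h3⟩ | ⟨h2, h3⟩⟩
    · rw [mem_eastCutLevel (by omega)] at h3
      omega
    · rw [mem_eastCutLevel (by omega)] at h3
      omega
  · rintro ⟨h1, h2, h3⟩
    refine ⟨h1, (by omega : t + 1 < a + c ∨ t + 1 = a + c).imp (fun h => ⟨h, ?_⟩) fun h => ⟨h, ?_⟩⟩
    · rw [mem_eastCutLevel (by omega)]
      omega
    · rw [mem_eastCutLevel (by omega)]
      omega

theorem up_mem_hexagon {a b c : ℕ} {x t : ℤ} : up x t ∈ hexagon a b c ↔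
    0 ≤ t ∧ t ≤ a + c - 1 ∧ -(c : ℤ) ≤ x ∧ x ≤ b - 1 ∧ 0 ≤ x + t ∧ x + t ≤ a + b - 1 := by
  rw [mem_hexagon]
  simp only [up, vertices, InHexagon, mem_insert, mem_singleton, forall_eq_or_imp, forall_eq]
  omega

theorem down_mem_hexagon {a b c : ℕ} {x t : ℤ} : down x t ∈ hexagon a b c ↔
    0 ≤ t ∧ t ≤ a + c - 1 ∧ -(c : ℤ) ≤ x ∧ x ≤ b - 1 ∧ -1 ≤ x + t ∧ x + t ≤ a + b - 2 := by
  rw [mem_hexagon]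
  simp only [down, vertices, InHexagon, mem_insert, mem_singleton, forall_eq_or_imp, forall_eq]
  omega

/-- The lozenges of the northwestern staircase. -/
def nwStaircase (a b c : ℕ) : Finset (Finset UnitTriangle) :=
  (staircase b a).image fun p => nwLozenge a c p.1 p.2

theorem mem_nwStaircase {a b c : ℕ} (hba : b ≤ a) {l : Finset UnitTriangle} :
    l ∈ nwStaircase a b c ↔ ∃ x t : ℤ, x - t < b - a - 2 * c ∧ -(c : ℤ) ≤ x ∧ t ≤ a + c - 1 ∧
      l = {up x t, down x t} := by
  simp only [nwStaircase, staircase, mem_image, mem_filter, mem_product, mem_range, nwLozenge,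
    min_eq_left hba, Prod.exists]
  constructor
  · rintro ⟨i, j, ⟨-, h⟩, rfl⟩
    exact ⟨_, _, by omega, by omega, by omega, rfl⟩
  · rintro ⟨x, t, h1, h2, h3, rfl⟩
    refine ⟨(x + c).toNat, (a + c - 1 - t).toNat, by omega, ?_⟩
    rw [pair_inj]
    omega

theorem mem_biUnion_eastLozenge {a b c : ℕ} (hac : a ≤ c) {s : UnitTriangle} :
    s ∈ (staircase a c).biUnion (fun p => eastLozenge a b p.1 p.2) ↔
      ∃ x t : ℤ, 2 * b ≤ 2 * x + t ∧ x ≤ b - 1 ∧ x + t ≤ a + b - 1 ∧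
        (s = up x t ∨ s = down x (t - 1)) := by
  simp only [staircase, mem_biUnion, mem_filter, mem_product, mem_range, eastLozenge,
    min_eq_left hac, Prod.exists, mem_insert, mem_singleton]
  constructor
  · rintro ⟨i, j, ⟨-, h⟩, hs⟩
    exact ⟨_, _, by omega, by omega, by omega, hs⟩
  · rintro ⟨x, t, h1, h2, h3, hs⟩
    refine ⟨(a + b - 1 - x - t).toNat, (b - 1 - x).toNat, by omega, ?_⟩
    rcases hs with rfl | rfl
    · rw [up_inj]
      omega
    · rw [down_inj]
      omega

theorem mem_biUnion_nwStaircase {a b c : ℕ} (hba : b ≤ a) {s : UnitTriangle} :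
    s ∈ (nwStaircase a b c).biUnion id ↔
      ∃ x t : ℤ, x - t < b - a - 2 * c ∧ -(c : ℤ) ≤ x ∧ t ≤ a + c - 1 ∧
        (s = up x t ∨ s = down x t) := by
  simp only [mem_biUnion, id, mem_nwStaircase hba]
  constructor
  · rintro ⟨l, ⟨x, t, h1, h2, h3, rfl⟩, h⟩
    exact ⟨x, t, h1, h2, h3, by simpa using h⟩
  · rintro ⟨x, t, h1, h2, h3, h⟩
    exact ⟨_, ⟨x, t, h1, h2, h3, rfl⟩, by simpa using h⟩

theorem Hd_eq {a b c : ℕ} (hba : b ≤ a) (hac : a ≤ c) :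
    Hd a b c = eastCut a b c \ (nwStaircase a b c).biUnion id := by
  have h : (staircase b a).biUnion (fun p => nwLozenge a c p.1 p.2) =
      (nwStaircase a b c).biUnion id := by
    rw [nwStaircase, image_biUnion]
    rfl
  ext s
  rw [Hd, h, mem_sdiff, mem_union, mem_sdiff, mem_biUnion_nwStaircase hba,
    mem_biUnion_eastLozenge hac, not_or, ← and_assoc, and_right_comm]
  refine and_congr_left fun _ => ?_
  obtain ⟨x, t, rfl | rfl⟩ := exists_up_or_down s
  · rw [up_mem_hexagon, up_mem_eastCut]
    constructor
    · rintro ⟨h1, h2⟩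
      by_contra h3
      exact h2 ⟨x, t, by omega, by omega, by omega, Or.inl rfl⟩
    · rintro h1
      refine ⟨by omega, ?_⟩
      rintro ⟨x', t', h2, h3, h4, h5 | h5⟩
      · rw [up_inj] at h5
        omega
      · exact up_ne_down _ _ _ _ h5
  · rw [down_mem_hexagon, down_mem_eastCut]
    constructor
    · rintro ⟨h1, h2⟩
      by_contra h3
      exact h2 ⟨x, t + 1, by omega, by omega, by omega, Or.inr (by rw [down_inj]; omega)⟩
    · rintro h1
      refine ⟨by omega, ?_⟩
      rintro ⟨x', t', h2, h3, h4, h5 | h5⟩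
      · exact down_ne_up _ _ _ _ h5
      · rw [down_inj] at h5
        omega

theorem mem_positions_pair {a b c : ℕ} (hba : b ≤ a) (hac : a ≤ c) {x t x' t' : ℤ} :
    ({up x t, down x' t'} : Finset UnitTriangle) ∈ nwPositions a b c ∪ eastPositions a b c ↔
      (x' = x ∧ t' = t ∧ x - t = b - a - 2 * c ∧ -(c : ℤ) ≤ x ∧ x ≤ b - c - 1) ∨
      (x' = x ∧ t' = t - 1 ∧ 2 * x + t = 2 * b - 1 ∧ x ≤ b - 1 ∧ x + t ≤ a + b - 1) := by
  simp only [nwPositions, eastPositions, indentations, mem_union, mem_image, mem_filter,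
    mem_product, mem_range, nwLozenge, eastLozenge, min_eq_left hac, min_eq_left hba, Prod.exists,
    pair_inj]
  refine or_congr ⟨?_, ?_⟩ ⟨?_, ?_⟩
  · rintro ⟨i, j, h⟩
    omega
  · rintro h
    exact ⟨(x + c).toNat, (a + c - 1 - t).toNat, by omega, by omega⟩
  · rintro ⟨i, j, h⟩
    omega
  · rintro h
    exact ⟨(a + b - 1 - x - t).toNat, (b - 1 - x).toNat, by omega, by omega⟩

open Classical in
/-- The weight that forces the lozenges of the northwestern staircase, and gives weight `1/2` to the
positions along the zig-zag cuts. -/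
def cutWeight (a b c : ℕ) (l : Finset UnitTriangle) : ℚ :=
  if ∃ x t : ℤ, x - t < b - a - 2 * c ∧ l = {up (x + 1) t, down x t} then 0
  else if l ∈ nwPositions a b c ∪ eastPositions a b c then 1 / 2 else 1

theorem cutWeight_left {a b c : ℕ} (hba : b ≤ a) (hac : a ≤ c) (x t : ℤ) :
    cutWeight a b c {up (x + 1) t, down x t} = if x - t < b - a - 2 * c then 0 else 1 := by
  by_cases h : x - t < b - a - 2 * c
  · rw [cutWeight, if_pos ⟨x, t, h, rfl⟩, if_pos h]
  · rw [cutWeight, if_neg, if_neg, if_neg h]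
    · rw [mem_positions_pair hba hac]
      omega
    · rintro ⟨x', t', h', h''⟩
      rw [pair_inj] at h''
      omega

theorem cutWeight_same {a b c : ℕ} (hba : b ≤ a) (hac : a ≤ c) (x t : ℤ) :
    cutWeight a b c {up x t, down x t} =
      if x - t = b - a - 2 * c ∧ -(c : ℤ) ≤ x ∧ x ≤ b - c - 1 then 1 / 2 else 1 := by
  rw [cutWeight, if_neg]
  · refine if_congr ((mem_positions_pair hba hac).trans ?_) rfl rfl
    omega
  · rintro ⟨x', t', h, h'⟩
    rw [pair_inj] at h'
    omega

theorem cutWeight_vertical {a b c : ℕ} (hba : b ≤ a) (hac : a ≤ c) (x t : ℤ) :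
    cutWeight a b c {up x t, down x (t - 1)} =
      if 2 * x + t = 2 * b - 1 ∧ x ≤ b - 1 ∧ x + t ≤ a + b - 1 then 1 / 2 else 1 := by
  rw [cutWeight, if_neg]
  · refine if_congr ((mem_positions_pair hba hac).trans ?_) rfl rfl
    omega
  · rintro ⟨x', t', h, h'⟩
    rw [pair_inj] at h'
    omega

/-- Induction on the distance from the top side: a downward triangle in the corner cannot go right
by `hT'`. It cannot go up either, as the triangle above it is outside the region or already covered.
-/
theorem nwStaircase_subset_of_tiling {a b c : ℕ} (hba : b ≤ a) (hac : a ≤ c)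
    {T : Finset (Finset UnitTriangle)} (hT : T ∈ tilings (eastCut a b c))
    (hT' : ∀ x t : ℤ, x - t < b - a - 2 * c → {up (x + 1) t, down x t} ∉ T) :
    nwStaircase a b c ⊆ T := by
  obtain ⟨h1, h2⟩ := mem_tilings.1 hT
  have key (k : ℕ) : ∀ x t : ℤ, x - t < b - a - 2 * c → -(c : ℤ) ≤ x → t = a + c - 1 - k →
      {up x t, down x t} ∈ T := by
    induction k with
    | zero =>
      intro x t hx hx' ht
      obtain ⟨l, ⟨hl, hxl⟩, -⟩ := h2 (down x t) (down_mem_eastCut.2 (by omega))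
      rcases (h1 l hl).2.eq_of_down_mem hxl with rfl | rfl | rfl
      · exact hl
      · exact absurd hl (hT' x t hx)
      · have := up_mem_eastCut.1 ((h1 _ hl).1 (mem_insert_self _ _))
        omega
    | succ k ih =>
      intro x t hx hx' ht
      obtain ⟨l, ⟨hl, hxl⟩, -⟩ := h2 (down x t) (down_mem_eastCut.2 (by omega))
      rcases (h1 l hl).2.eq_of_down_mem hxl with rfl | rfl | rfl
      · exact hl
      · exact absurd hl (hT' x t hx)
      · have := eq_of_mem_tiling hT hl (ih x (t + 1) (by omega) hx' (by push_cast at ht; omega))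
          (t := up x (t + 1)) (by simp) (by simp)
        rw [pair_inj] at this
        omega
  intro l hl
  obtain ⟨x, t, h3, h4, h5, rfl⟩ := (mem_nwStaircase hba).1 hl
  exact key (a + c - 1 - t).toNat x t h3 h4 (by omega)

theorem LStarStar_eq_wsum {a b c : ℕ} (hba : b ≤ a) (hac : a ≤ c) :
    LStarStar a b c = wsum (eastCut a b c) (cutWeight a b c) := by
  have hB : ∀ l ∈ nwStaircase a b c, l ⊆ eastCut a b c ∧ IsLozenge l := by
    intro l hl
    obtain ⟨x, t, h3, h4, h5, rfl⟩ := (mem_nwStaircase hba).1 hl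
    refine ⟨?_, isLozenge_iff.2 ⟨_, _, _, _, rfl, by omega⟩⟩
    simp only [insert_subset_iff, singleton_subset_iff, up_mem_eastCut, down_mem_eastCut]
    omega
  have hd : ∀ l ∈ nwStaircase a b c, ∀ m ∈ nwStaircase a b c, ∀ s ∈ l, s ∈ m → l = m := by
    intro l hl m hm s hsl hsm
    obtain ⟨x, t, h3, h4, h5, rfl⟩ := (mem_nwStaircase hba).1 hl
    obtain ⟨x', t', h3', h4', h5', rfl⟩ := (mem_nwStaircase hba).1 hm
    simp only [mem_insert, mem_singleton] at hsl hsm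
    rcases hsl with rfl | rfl <;>
    simp only [up_inj, down_inj, up_ne_down, down_ne_up, or_false, false_or] at hsm <;>
    · obtain ⟨rfl, rfl⟩ := hsm
      rfl
  have h1 : wsum (eastCut a b c) (cutWeight a b c) =
      ∑ T ∈ tilings (eastCut a b c) with nwStaircase a b c ⊆ T, ∏ l ∈ T, cutWeight a b c l := by
    rw [wsum, sum_filter]
    refine sum_congr rfl fun T hT => ?_
    split_ifs with h
    · rfl
    · have : ¬ ∀ x t : ℤ, x - t < b - a - 2 * c → {up (x + 1) t, down x t} ∉ T :=
        fun h' => h (nwStaircase_subset_of_tiling hba hac hT h')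
      push Not at this
      obtain ⟨x, t, hxt, hl⟩ := this
      refine prod_eq_zero hl ?_
      rw [cutWeight_left hba hac, if_pos hxt]
  rw [h1, sum_tilings_superset hB hd, prod_eq_one, one_mul, ← Hd_eq hba hac, LStarStar,
    weightedCount_eq_wsum]
  · refine sum_congr rfl fun T hT => prod_congr rfl fun l hl => ?_
    rw [cutWeight, if_neg]
    rintro ⟨x, t, hxt, rfl⟩
    have h2 : down x t ∈ Hd a b c := ((mem_tilings.1 hT).1 _ hl).1 (by simp)
    rw [Hd_eq hba hac, mem_sdiff, down_mem_eastCut, mem_biUnion_nwStaircase hba] at h2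
    exact h2.2 ⟨x, t, hxt, by omega, by omega, Or.inr rfl⟩
  · intro l hl
    obtain ⟨x, t, h3, h4, h5, rfl⟩ := (mem_nwStaircase hba).1 hl
    rw [cutWeight_same hba hac, if_neg]
    omega

/-! ### Single paths: reflection in the eastern cut, freezing at the northwestern cut -/

/-- The binomial coefficient `n` choose `k` for an integer `k`. -/
def intChoose (n : ℕ) (k : ℤ) : ℚ := if 0 ≤ k then n.choose k.toNat else 0

theorem intChoose_natCast (n k : ℕ) : intChoose n k = n.choose k := by simp [intChoose]

theorem intChoose_zero (k : ℤ) : intChoose 0 k = if k = 0 then 1 else 0 := by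
  rw [intChoose]
  split_ifs with h1 h2 h2
  · simp [h2]
  · rw [Nat.choose_eq_zero_of_lt (by omega), Nat.cast_zero]
  · omega
  · rfl

theorem intChoose_of_lt {n : ℕ} {k : ℤ} (h : n < k) : intChoose n k = 0 := by
  rw [intChoose, if_pos (by omega), Nat.choose_eq_zero_of_lt (by omega), Nat.cast_zero]

theorem intChoose_of_neg {n : ℕ} {k : ℤ} (h : k < 0) : intChoose n k = 0 := by
  rw [intChoose, if_neg (by omega)]

theorem intChoose_succ (n : ℕ) (k : ℤ) :
    intChoose (n + 1) k = intChoose n k + intChoose n (k - 1) := by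
  rcases lt_or_ge k 0 with h | h
  · rw [intChoose_of_neg h, intChoose_of_neg h, intChoose_of_neg (by omega), add_zero]
  · lift k to ℕ using h
    cases k with
    | zero => rw [intChoose_of_neg (k := ((0 : ℕ) : ℤ) - 1) (by omega)]; simp [intChoose]
    | succ k =>
      rw [show ((k + 1 : ℕ) : ℤ) - 1 = (k : ℕ) by push_cast; ring, intChoose_natCast,
        intChoose_natCast, intChoose_natCast, Nat.choose_succ_succ]
      push_cast
      ring

theorem intChoose_symm (n : ℕ) (k : ℤ) : intChoose n (n - k) = intChoose n k := by
  rcases lt_or_ge k 0 with h | h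
  · rw [intChoose_of_neg h, intChoose_of_lt (by omega)]
  · lift k to ℕ using h
    rcases lt_or_ge n k with h' | h'
    · rw [intChoose_of_neg (by omega), intChoose_of_lt (by omega)]
    · rw [← Nat.cast_sub h', intChoose_natCast, intChoose_natCast, Nat.choose_symm h']

/-- The number of lattice paths from `k` at height `0` to `x` at height `t` that do not cross the
line `2 x + t = 2 b - 1`, every visit of it counting twice. -/
def reflectedPaths (b t : ℕ) (k x : ℤ) : ℚ :=
  intChoose t (k - x) + intChoose t (2 * b - 1 - k - x)

theorem reflectedPaths_succ (b t : ℕ) (k x : ℤ) :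
    reflectedPaths b (t + 1) k x = reflectedPaths b t k x + reflectedPaths b t k (x + 1) := by
  simp only [reflectedPaths, intChoose_succ, ← sub_sub]
  ring

/-- At height `t` the points `x` and `x + 1` are mirror images in the line `2 x + t = 2 b - 1`. -/
theorem reflectedPaths_add_one {b t : ℕ} {x : ℤ} (h : 2 * x + t + 1 = 2 * b - 1) (k : ℤ) :
    reflectedPaths b t k (x + 1) = reflectedPaths b t k x := by
  rw [reflectedPaths, reflectedPaths, ← intChoose_symm t (k - x),
    ← intChoose_symm t (2 * b - 1 - k - x), add_comm]
  congr 2 <;> omega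

theorem reflectedPaths_eq_zero {b t : ℕ} {k x : ℤ} (h0 : 0 ≤ k) (hb : k < b) (h : x + t < 0) :
    reflectedPaths b t k x = 0 := by
  rw [reflectedPaths, intChoose_of_lt (by omega), intChoose_of_lt (by omega), add_zero]

/-- The weighted number of lattice paths from `k` at height `0` to `x` at height `t` in the region
with the forced northwestern staircase. -/
def cutPaths (a b c : ℕ) (t : ℤ) (k : Fin b) (x : ℤ) : ℚ :=
  if b - a - 2 * c ≤ x - t then
    (if 2 * x + t = 2 * b - 1 then 1 / 2 else 1) * reflectedPaths b t.toNat k x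
  else 1 / 2 * reflectedPaths b (x - (b - a - 2 * c)).toNat k x +
    reflectedPaths b (x - (b - a - 2 * c)).toNat k (x + 1)

theorem cutWeight_vertical_of_mem {a b c : ℕ} (hba : b ≤ a) (hac : a ≤ c) {x : ℤ} {t : ℤ}
    (ht : 0 ≤ t) (hx : x ∈ eastCutLevel a b c t) :
    cutWeight a b c {up x t, down x (t - 1)} = if 2 * x + t = 2 * b - 1 then 1 / 2 else 1 := by
  rw [mem_eastCutLevel ht] at hx
  rw [cutWeight_vertical hba hac]
  refine if_congr ?_ rfl rfl
  omega

/-- `reflectedPaths` already doubles a visit of the line at the endpoint, whereas the path gains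
this factor only on leaving; the `1 / 2` in `cutPaths` accounts for the difference. -/
theorem cutWeight_ratio_mul_cutPaths {a b c : ℕ} (hba : b ≤ a) (hac : a ≤ c) {x : ℤ} {t : ℕ}
    (hx : x ∈ eastCutLevel a b c t) (hxt : (b : ℤ) - a - 2 * c ≤ x - t) (w : ℚ) (k : Fin b) :
    w / cutWeight a b c {up x t, down x (t - 1)} * cutPaths a b c t k x =
      w * reflectedPaths b t k x := by
  rw [cutWeight_vertical_of_mem hba hac (by omega) hx, cutPaths, if_pos hxt, Int.toNat_natCast]
  split_ifs <;> field_simp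

theorem cutPaths_succ {a b c : ℕ} (hba : b ≤ a) (hac : a ≤ c) {t : ℕ}
    (k : Fin b) {y : ℤ} (hy : y ∈ eastCutLevel a b c (t + 1)) :
    cutPaths a b c (t + 1) k y = ∑ e : Bool,
      (if y + e.toNat ∈ eastCutLevel a b c t then
        cutWeight a b c {up (y + e.toNat) t, down y t} /
        cutWeight a b c {up (y + e.toNat) t, down (y + e.toNat) (t - 1)} else 0) *
        cutPaths a b c t k (y + e.toNat) := by
  rw [mem_eastCutLevel (by omega)] at hy
  rw [Fintype.sum_bool]
  simp only [Bool.toNat_true, Bool.toNat_false, Nat.cast_one, Nat.cast_zero, add_zero]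
  have hk := k.isLt
  -- The step ends before the northwestern cut, crosses it (weights `1 / 2` and 1 for the two
  -- directions), or lies behind it, where `x` can no longer change.
  rcases lt_trichotomy ((b : ℤ) - a - 2 * c) (y - t) with h | h | h
  · have h1 : (if y + 1 ∈ eastCutLevel a b c t then cutWeight a b c {up (y + 1) t, down y t} /
        cutWeight a b c {up (y + 1) t, down (y + 1) (t - 1)} else 0) * cutPaths a b c t k (y + 1) =
        if 2 * y + t + 1 = 2 * b - 1 then 0 else reflectedPaths b t k (y + 1) := by
      split_ifs with h1 h2 h2
      · rw [mem_eastCutLevel (by omega)] at h1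
        omega
      · rw [cutWeight_ratio_mul_cutPaths hba hac h1 (by omega), cutWeight_left hba hac,
          if_neg (by omega), one_mul]
      · rw [zero_mul]
      · rw [mem_eastCutLevel (by omega)] at h1
        omega
    have h2 : (if y ∈ eastCutLevel a b c t then cutWeight a b c {up y t, down y t} /
        cutWeight a b c {up y t, down y (t - 1)} else 0) * cutPaths a b c t k y =
        reflectedPaths b t k y := by
      split_ifs with h1
      · rw [cutWeight_ratio_mul_cutPaths hba hac h1 (by omega), cutWeight_same hba hac,
          if_neg (by omega), one_mul]
      · rw [mem_eastCutLevel (by omega)] at h1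
        rw [zero_mul, reflectedPaths_eq_zero (by omega) (by omega) (by omega)]
    rw [h1, h2, cutPaths, if_pos (by omega), show ((t : ℤ) + 1).toNat = t + 1 by omega,
      reflectedPaths_succ, ← add_assoc]
    split_ifs with h3
    · rw [reflectedPaths_add_one h3]
      ring
    · ring
  · have h1 : y + 1 ∈ eastCutLevel a b c t := by
      rw [mem_eastCutLevel (by omega)]
      omega
    have h2 : y ∈ eastCutLevel a b c t := by
      rw [mem_eastCutLevel (by omega)]
      omega
    rw [if_pos h1, if_pos h2, cutWeight_ratio_mul_cutPaths hba hac h1 (by omega),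
      cutWeight_ratio_mul_cutPaths hba hac h2 (by omega), cutWeight_left hba hac,
      if_neg (by omega), cutWeight_same hba hac, if_pos (by omega), cutPaths, if_neg (by omega),
      show (y - (b - a - 2 * c)).toNat = t by omega]
    ring
  · have h2 : y ∈ eastCutLevel a b c t := by
      rw [mem_eastCutLevel (by omega)]
      omega
    have e1 : cutWeight a b c {up (y + 1) t, down y t} = 0 := by
      rw [cutWeight_left hba hac, if_pos h]
    have e2 : cutWeight a b c {up y t, down y t} = 1 := by
      rw [cutWeight_same hba hac, if_neg (by omega)]
    have e3 : cutWeight a b c {up y t, down y (t - 1)} = 1 := by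
      rw [cutWeight_vertical_of_mem hba hac (by omega) h2, if_neg (by omega)]
    rw [if_pos h2, e1, e2, e3, zero_div, ite_self, zero_mul, zero_add, div_one, one_mul, cutPaths,
      cutPaths, if_neg (by omega), if_neg (by omega)]

theorem eastCutLevel_zero (a b c : ℕ) : eastCutLevel a b c 0 = Ico (0 : ℤ) b := by
  ext x
  rw [mem_eastCutLevel le_rfl, mem_Ico]
  omega

theorem eastCutLevel_top {a b c : ℕ} (hac : a ≤ c) :
    eastCutLevel a b c (a + c) = univ.image fun j : Fin b => -(c : ℤ) + j := by
  ext x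
  rw [mem_eastCutLevel (by omega), mem_image]
  constructor
  · intro h
    exact ⟨⟨(x + c).toNat, by omega⟩, mem_univ _, by simp only; omega⟩
  · rintro ⟨j, -, rfl⟩
    omega

theorem det_cutPaths_zero {a b c : ℕ} (hba : b ≤ a) (y : Fin b → ℤ) (hy : StrictMono y)
    (hyX : ∀ j, y j ∈ eastCutLevel a b c 0) :
    (Matrix.of fun j k => cutPaths a b c 0 k (y j)).det = 1 := by
  simp only [eastCutLevel_zero, mem_Ico] at hyX
  let f : Fin b → Fin b := fun j => ⟨(y j).toNat, by have := hyX j; omega⟩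
  have hf : StrictMono f := by
    intro i j hij
    have := hy hij
    have := hyX i
    simp only [f, Fin.mk_lt_mk]
    omega
  -- A strictly increasing self-map of `Fin b` is the identity, so the matrix at height 0 is the
  -- identity matrix.
  have hid : f = id := (hf.range_inj strictMono_id).1
    (by rw [Set.range_id, (Finite.injective_iff_surjective.1 hf.injective).range_eq])
  have hyj (j : Fin b) : y j = (j : ℕ) := by
    have h1 := congrArg Fin.val (congrFun hid j)
    have := hyX j
    simp only [f, id] at h1
    omega
  rw [← Matrix.det_one (n := Fin b)]
  congr 1
  ext j k
  have hj := j.isLt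
  have hk := k.isLt
  rw [Matrix.of_apply, hyj, cutPaths, if_pos (by omega), if_neg (by omega), Int.toNat_zero,
    reflectedPaths, intChoose_zero, intChoose_zero, if_neg (c := 2 * (b : ℤ) - 1 - k - j = 0)
    (by omega), Matrix.one_apply, one_mul, add_zero]
  refine if_congr ?_ rfl rfl
  rw [Fin.ext_iff]
  omega

theorem prod_cutWeight_vertical {a b c : ℕ} (hba : b ≤ a) (hac : a ≤ c) :
    ∏ s ∈ range (a + c), ∏ x ∈ eastCutLevel a b c s, cutWeight a b c {up x s, down x (s - 1)} =
      (1 / 2) ^ a := by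
  have h1 : ∏ s ∈ range (a + c), ∏ x ∈ eastCutLevel a b c s,
      cutWeight a b c {up x s, down x (s - 1)} = ∏ s ∈ range (a + c), ∏ x ∈ eastCutLevel a b c s,
        if 2 * x + s = 2 * b - 1 then 1 / 2 else (1 : ℚ) :=
    prod_congr rfl fun s _ => prod_congr rfl fun x hx =>
      cutWeight_vertical_of_mem hba hac (by omega) hx
  rw [h1, prod_sigma', prod_ite, prod_const_one, mul_one, prod_const]
  congr 1
  conv_rhs => rw [← card_range a]
  -- The line `2 x + s = 2 b - 1` meets only odd heights, at the `a` points `s = 2 m + 1`, `x = b -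
  -- 1 - m`.
  refine card_nbij' (fun p => (b - 1 - p.2).toNat) (fun m => ⟨2 * m + 1, b - 1 - m⟩) ?_ ?_ ?_ ?_
  · rintro ⟨s, x⟩ h
    simp only [coe_filter, mem_sigma, mem_range, Set.mem_ofPred_eq,
      mem_eastCutLevel (Int.natCast_nonneg _)] at h
    simp only [coe_range, Set.mem_Iio]
    omega
  · intro m hm
    simp only [coe_range, Set.mem_Iio] at hm
    simp only [coe_filter, mem_sigma, mem_range, Set.mem_ofPred_eq,
      mem_eastCutLevel (Int.natCast_nonneg _)]
    push_cast
    omega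
  · rintro ⟨s, x⟩ h
    simp only [coe_filter, mem_sigma, mem_range, Set.mem_ofPred_eq,
      mem_eastCutLevel (Int.natCast_nonneg _)] at h
    obtain rfl : s = 2 * ((b : ℤ) - 1 - x).toNat + 1 := by omega
    have : (b : ℤ) - 1 - (((b : ℤ) - 1 - x).toNat : ℕ) = x := by omega
    simp only [this]
  · intro m hm
    simp

/-- The weighted tiling enumerator as a determinant of binomial coefficients. -/
theorem LStarStar_eq_det {a b c : ℕ} (hba : b ≤ a) (hac : a ≤ c) :
    LStarStar a b c = (1 / 2) ^ a * (Matrix.of fun j k : Fin b =>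
      1 / 2 * reflectedPaths b (a + c - b + j) k (-c + j) +
        reflectedPaths b (a + c - b + j) k (-c + j + 1)).det := by
  have hmono : StrictMono fun j : Fin b => -(c : ℤ) + j := fun i j h => by
    have : (i : ℕ) < j := h
    simp only
    omega
  have := wsum_sweep (X := eastCutLevel a b c) (N := a + c) (w := cutWeight a b c)
    (fun t x => by rw [cutWeight_vertical hba hac]; split_ifs <;> norm_num)
    (by rw [eastCutLevel_zero]; simp) (cutPaths a b c)
    (det_cutPaths_zero hba) (fun t _ k y hy => cutPaths_succ hba hac k hy) (a + c) le_rfl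
    (fun j : Fin b => -(c : ℤ) + j) hmono (fun j => by
      push_cast
      rw [eastCutLevel_top hac]
      exact mem_image_of_mem _ (mem_univ j))
  rw [LStarStar_eq_wsum hba hac, eastCut, eastCutLevel_top hac, this,
    prod_cutWeight_vertical hba hac]
  congr 2
  ext j k
  have := j.isLt
  rw [Matrix.of_apply, Matrix.of_apply, cutPaths, if_neg (by push_cast; omega),
    show (-(c : ℤ) + j - (b - a - 2 * c)).toNat = a + c - b + j by omega]

/-! ### Column operations on the binomial determinant -/

theorem intChoose_add (t m : ℕ) (y : ℤ) :
    intChoose (t + m) y = ∑ l ∈ range (m + 1), (m.choose l : ℚ) * intChoose t (y - l) := by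
  induction m generalizing y with
  | zero => simp
  | succ m ih =>
    have h1 : intChoose (t + m) y = ∑ l ∈ range (m + 1),
        (m.choose (l + 1) : ℚ) * intChoose t (y - ((l + 1 : ℕ) : ℤ)) + intChoose t y := by
      rw [ih, ← add_zero (∑ l ∈ range (m + 1), (m.choose l : ℚ) * intChoose t (y - l))]
      have : (0 : ℚ) = (m.choose (m + 1) : ℚ) * intChoose t (y - ((m + 1 : ℕ) : ℤ)) := by simp
      rw [this, ← sum_range_succ (fun l => (m.choose l : ℚ) * intChoose t (y - l)),
        sum_range_succ']
      simp
    rw [← add_assoc, intChoose_succ, h1, ih, sum_range_succ' _ (m + 1), add_right_comm,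
      ← sum_add_distrib]
    congr 1
    · refine sum_congr rfl fun l _ => ?_
      rw [Nat.choose_succ_succ, show y - ((l + 1 : ℕ) : ℤ) = y - 1 - l by push_cast; ring]
      push_cast
      ring
    · simp

/-- Vandermonde's convolution with the terms `l = r - i` and `l = r + 1 + i` paired, whose
coefficients in row `2 r + 1` of Pascal's triangle agree. -/
theorem sum_choose_mul_intChoose (t r : ℕ) (y : ℤ) :
    ∑ i ∈ range (r + 1), ((2 * r + 1).choose (r - i) : ℚ) *
      (intChoose t (y - i) + intChoose t (y + 1 + i)) = intChoose (t + (2 * r + 1)) (y + 1 + r) := by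
  rw [intChoose_add, show 2 * r + 1 + 1 = (r + 1) + (r + 1) by ring, sum_range_add _ (r + 1) (r + 1),
    ← sum_range_reflect (fun l => ((2 * r + 1).choose l : ℚ) * intChoose t (y + 1 + r - l)) (r + 1),
    ← sum_add_distrib]
  refine sum_congr rfl fun i hi => ?_
  have hi : i ≤ r := Nat.lt_succ_iff.1 (mem_range.1 hi)
  rw [show r + 1 - 1 - i = r - i by omega, show r + 1 + i = 2 * r + 1 - (r - i) by omega,
    Nat.choose_symm (by omega), show y + 1 + r - ((r - i : ℕ) : ℤ) = y + 1 + i by omega,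
    show y + 1 + r - ((2 * r + 1 - (r - i) : ℕ) : ℤ) = y - i by omega]
  ring

theorem factorial_mul_choose (n q : ℕ) :
    (q ! : ℚ) * n.choose q = rising ((n : ℚ) - q + 1) q := by
  induction q with
  | zero => simp [rising_zero]
  | succ q ih =>
    rw [rising_succ', show (n : ℚ) - ((q + 1 : ℕ) : ℚ) + 1 = n - q by push_cast; ring, ← ih,
      Nat.factorial_succ]
    rcases le_or_gt q n with h | h
    · have := congrArg (Nat.cast : ℕ → ℚ) (Nat.choose_succ_right_eq n q)
      push_cast [Nat.cast_sub h] at this ⊢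
      linear_combination (q ! : ℚ) * this
    · rw [Nat.choose_eq_zero_of_lt h, Nat.choose_eq_zero_of_lt (by omega)]
      simp

/-- Over the denominator `(q + 1)!` the linear factors add up: `(n - q) / 2 + (q + 1) = (n + q + 2)
/ 2`. -/
theorem half_choose_add_choose (n q : ℕ) :
    (1 / 2 : ℚ) * n.choose (q + 1) + n.choose q =
      1 / 2 * (n + q + 2) * (rising ((n : ℚ) - q + 1) q / ((q + 1)! : ℕ)) := by
  have h1 := factorial_mul_choose n (q + 1)
  have h2 := factorial_mul_choose n q
  rw [rising_succ', show (n : ℚ) - ((q + 1 : ℕ) : ℚ) + 1 = n - q by push_cast; ring] at h1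
  have h3 : ((q + 1)! : ℚ) ≠ 0 := Nat.cast_ne_zero.2 (Nat.factorial_ne_zero _)
  rw [← mul_div_assoc, eq_div_iff h3]
  rw [Nat.factorial_succ] at h1 ⊢
  push_cast at h1 ⊢
  linear_combination 1 / 2 * h1 + (q + 1 : ℚ) * h2

/-- The determinant of binomial coefficients is a multiple of `pochDet`. -/
theorem det_reflectedPaths {a b c : ℕ} (hba : b ≤ a) :
    (Matrix.of fun j k : Fin b => 1 / 2 * reflectedPaths b (a + c - b + j) k (-c + j) +
        reflectedPaths b (a + c - b + j) k (-c + j + 1)).det =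
      (∏ i : Fin b, (1 / 2 * (a + 2 * c + 3 * i + 2) : ℚ)) * pochDet b c (a : ℚ) := by
  -- The coefficients of `sum_choose_mul_intChoose` as a unitriangular matrix. After both index sets
  -- are reversed, the two binomials of an entry have lower indices `y - i` and `y + 1 + i`, as that
  -- lemma requires.
  let L : Matrix (Fin b) (Fin b) ℚ :=
    Matrix.of fun i r => if i ≤ r then ((2 * (r : ℕ) + 1).choose (r - i) : ℚ) else 0
  have hL : L.det = 1 := by
    rw [Matrix.det_of_isUpperTriangular]
    · exact prod_eq_one fun i _ => by simp [L]
    · intro i j hij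
      simp only [id] at hij
      simp [L, hij]
  have hdet (A : Matrix (Fin b) (Fin b) ℚ) :
      A.det = ((A.submatrix Fin.revPerm Fin.revPerm * L).transpose).det := by
    rw [Matrix.det_transpose, Matrix.det_mul, hL, mul_one, Matrix.det_submatrix_equiv_self]
  rw [hdet, pochDet, ← Matrix.det_mul_column]
  congr 1
  ext r j
  have hr := r.isLt
  have hj := j.isLt
  have key (y : ℤ) : ∑ i : Fin b, (intChoose (a + c - 1 - j) (y - (i : ℕ)) +
      intChoose (a + c - 1 - j) (y + 1 + (i : ℕ))) * L i r =
      intChoose (a + c + 2 * r - j) (y + 1 + (r : ℕ)) := by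
    let F : ℕ → ℚ := fun i => if i ≤ r then ((2 * (r : ℕ) + 1).choose (r - i) : ℚ) *
      (intChoose (a + c - 1 - j) (y - i) + intChoose (a + c - 1 - j) (y + 1 + i)) else 0
    have h1 : ∑ i : Fin b, (intChoose (a + c - 1 - j) (y - (i : ℕ)) +
        intChoose (a + c - 1 - j) (y + 1 + (i : ℕ))) * L i r = ∑ i : Fin b, F i := by
      refine sum_congr rfl fun i _ => ?_
      simp only [L, F, Matrix.of_apply, Fin.le_def]
      split_ifs <;> ring
    rw [h1, Fin.sum_univ_eq_sum_range F b, ← sum_subset (range_subset_range.2 hr),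
      show a + c + 2 * r - j = (a + c - 1 - j) + (2 * r + 1) by omega, ← sum_choose_mul_intChoose]
    · exact sum_congr rfl fun i hi => if_pos (Nat.lt_succ_iff.1 (mem_range.1 hi))
    · intro i _ hi
      exact if_neg (by simpa using hi)
  have entry (i : Fin b) : 1 / 2 * reflectedPaths b (a + c - b + (Fin.rev j : ℕ)) (Fin.rev i : ℕ)
        (-c + (Fin.rev j : ℕ)) +
        reflectedPaths b (a + c - b + (Fin.rev j : ℕ)) (Fin.rev i : ℕ)
        (-c + (Fin.rev j : ℕ) + 1) =
      1 / 2 * (intChoose (a + c - 1 - j) (((c + j : ℕ) : ℤ) - (i : ℕ)) +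
        intChoose (a + c - 1 - j) (((c + j : ℕ) : ℤ) + 1 + (i : ℕ))) +
      (intChoose (a + c - 1 - j) (((c + j : ℕ) : ℤ) - 1 - (i : ℕ)) +
        intChoose (a + c - 1 - j) (((c + j : ℕ) : ℤ) - 1 + 1 + (i : ℕ))) := by
    have hi := i.isLt
    rw [reflectedPaths, reflectedPaths, Fin.val_rev, Fin.val_rev,
      show a + c - b + (b - (j + 1)) = a + c - 1 - j by omega]
    rw [show ((b - (i + 1) : ℕ) : ℤ) - (-c + ((b - (j + 1) : ℕ) : ℤ)) =
        ((c + j : ℕ) : ℤ) - (i : ℕ) by omega,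
      show 2 * (b : ℤ) - 1 - ((b - (i + 1) : ℕ) : ℤ) - (-c + ((b - (j + 1) : ℕ) : ℤ)) =
        ((c + j : ℕ) : ℤ) + 1 + (i : ℕ) by omega,
      show ((b - (i + 1) : ℕ) : ℤ) - (-c + ((b - (j + 1) : ℕ) : ℤ) + 1) =
        ((c + j : ℕ) : ℤ) - 1 - (i : ℕ) by omega,
      show 2 * (b : ℤ) - 1 - ((b - (i + 1) : ℕ) : ℤ) - (-c + ((b - (j + 1) : ℕ) : ℤ) + 1) =
        ((c + j : ℕ) : ℤ) - 1 + 1 + (i : ℕ) by omega]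
  rw [Matrix.transpose_apply, Matrix.mul_apply, Matrix.of_apply, Matrix.of_apply]
  have h1 : ∀ i ∈ (univ : Finset (Fin b)), Matrix.submatrix (Matrix.of fun j k : Fin b =>
      1 / 2 * reflectedPaths b (a + c - b + j) k (-c + j) +
        reflectedPaths b (a + c - b + j) k (-c + j + 1)) Fin.revPerm Fin.revPerm j i * L i r =
      1 / 2 * ((intChoose (a + c - 1 - j) (((c + j : ℕ) : ℤ) - (i : ℕ)) +
        intChoose (a + c - 1 - j) (((c + j : ℕ) : ℤ) + 1 + (i : ℕ))) * L i r) +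
      (intChoose (a + c - 1 - j) (((c + j : ℕ) : ℤ) - 1 - (i : ℕ)) +
        intChoose (a + c - 1 - j) (((c + j : ℕ) : ℤ) - 1 + 1 + (i : ℕ))) * L i r := by
    intro i _
    rw [← mul_assoc, ← add_mul, ← entry]
    rfl
  rw [sum_congr rfl h1, sum_add_distrib, ← mul_sum, key, key]
  rw [show ((c + j : ℕ) : ℤ) + 1 + (r : ℕ) = ((c + r + j + 1 : ℕ) : ℤ) by push_cast; ring,
    show ((c + j : ℕ) : ℤ) - 1 + 1 + (r : ℕ) = ((c + r + j : ℕ) : ℤ) by push_cast; ring,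
    -- Here `n = a + c + 2 r - j` and `q = c + r + j`, so `n + q + 2 = a + 2 c + 3 r + 2` is free of
    -- `j` and comes out of row `r`.
    intChoose_natCast, intChoose_natCast, half_choose_add_choose]
  have hN : ((a + c + 2 * r - j : ℕ) : ℚ) = a + c + 2 * r - j := by
    rw [Nat.cast_sub (by omega)]
    push_cast
    ring
  rw [hN]
  push_cast
  congr 2
  · ring
  · congr 1
    ring

/-! ### Return to rational numbers and comparison with the stated product -/

theorem pochDet_eq_pochProd_rat (b c : ℕ) (x : ℚ) : pochDet b c x = pochProd b c x := by
  have hr (y : ℚ) (n : ℕ) : ((rising y n : ℚ) : ℝ) = rising (y : ℝ) n := by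
    simp [rising]
  have h1 : ((pochDet b c x : ℚ) : ℝ) = pochDet b c (x : ℝ) := by
    rw [pochDet, ← Rat.coe_castHom, RingHom.map_det, pochDet]
    congr 1
    ext i j
    simp [hr]
  have h2 : ((pochProd b c x : ℚ) : ℝ) = pochProd b c (x : ℝ) := by
    simp [pochProd, longProd, stairProd, hr]
  exact_mod_cast h1.trans ((pochDet_eq_pochProd b c x).trans h2.symm)

theorem factorial_mul_rising (n k : ℕ) : (n ! : ℚ) * rising ((n : ℚ) + 1) k = (n + k)! := by
  induction k with
  | zero => simp [rising_zero]
  | succ k ih =>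
    rw [rising_succ, ← mul_assoc, ih, ← add_assoc, Nat.factorial_succ]
    push_cast
    ring

end LozengeTiling

end

theorem theorem1p2 (a b c : ℕ) (hba : b ≤ a) (hac : a ≤ c) :
    LozengeTiling.LStarStar a b c =
      (2 : ℚ) ^ (-(a : ℤ) - (b : ℤ)) *
        ∏ j ∈ Finset.Icc 1 b,
          (((j - 1)! : ℕ) : ℚ) * (((a + c - b + 2 * j - 1)! : ℕ) : ℚ) *
              LozengeTiling.shiftedFactorial ((c : ℚ) - a + 3 * j - 1) (b - j) *
              LozengeTiling.shiftedFactorial ((a : ℚ) + 2 * c + 3 * j - 1) (b - j + 1) /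
            ((((b + c + j - 1)! : ℕ) : ℚ) * (((a - b + 2 * j - 1)! : ℕ) : ℚ)) := by
  open LozengeTiling Finset in
  have h2 : (2 : ℚ) ^ (-(a : ℤ) - (b : ℤ)) = (1 / 2) ^ a * ∏ _m ∈ range b, (1 / 2 : ℚ) := by
    rw [prod_const, card_range, ← pow_add, one_div, inv_pow, ← zpow_natCast, ← zpow_neg]
    congr 1
    push_cast
    ring
  have h1 (f : ℕ → ℚ) : ∏ j ∈ Icc 1 b, f j = ∏ m ∈ range b, f (m + 1) := by
    rw [range_eq_Ico, prod_Ico_add' f 0 b 1]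
    congr 1
  rw [LStarStar_eq_det hba hac, det_reflectedPaths hba, pochDet_eq_pochProd_rat, h1, h2, mul_assoc,
    Fin.prod_univ_eq_prod_range (fun i => (1 / 2 * (a + 2 * c + 3 * i + 2) : ℚ)) b, pochProd,
    factProd, denomProd, longProd, stairProd, stairProd]
  push_cast
  simp only [← prod_mul_distrib, ← prod_div_distrib]
  congr 1
  refine prod_congr rfl fun m hm => ?_
  -- With `j = m + 1`, `k = b - j` and `d = a - b` all truncated subtractions disappear. The factors
  -- now match one by one: `h3` writes the rising factorial of length `c` as a quotient of
  -- factorials, and in `h4` the row factor lengthens the last rising factorial from `b - j` to `b -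
  -- j + 1`.
  obtain ⟨k, rfl⟩ := Nat.exists_eq_add_of_lt (mem_range.1 hm)
  obtain ⟨d, rfl⟩ := Nat.exists_eq_add_of_le hba
  have h3 := factorial_mul_rising (d + 2 * m + 1) c
  have h4 := rising_succ' ((m + k + 1 + d : ℕ) + 2 * c + 3 * m + 2 : ℚ) k
  have h5 : ((d + 2 * m + 1)! : ℚ) ≠ 0 := Nat.cast_ne_zero.2 (Nat.factorial_ne_zero _)
  have h6 : ((m + k + 1 + c + m)! : ℚ) ≠ 0 := Nat.cast_ne_zero.2 (Nat.factorial_ne_zero _)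
  have e1 : m + k + 1 + d + c - (m + k + 1) + 2 * (m + 1) - 1 = d + 2 * m + 1 + c := by omega
  have e2 : m + k + 1 + d - (m + k + 1) + 2 * (m + 1) - 1 = d + 2 * m + 1 := by omega
  have e3 : m + k + 1 + c + (m + 1) - 1 = m + k + 1 + c + m := by omega
  have e4 : m + k + 1 - (m + 1) = k := by omega
  have e5 : m + k + 1 - 1 - m = k := by omega
  have e6 : ((m + k + 1 + d : ℕ) : ℚ) - ((m + k + 1 : ℕ) : ℚ) + 2 + 2 * m =
      ((d + 2 * m + 1 : ℕ) : ℚ) + 1 := by push_cast; ring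
  have e7 : (c : ℚ) - ((m + k + 1 + d : ℕ) : ℚ) + 3 * (m + 1) - 1 =
      c - ((m + k + 1 + d : ℕ) : ℚ) + 3 * m + 2 := by ring
  have e8 : ((m + k + 1 + d : ℕ) : ℚ) + 2 * c + 3 * (m + 1) - 1 =
      ((m + k + 1 + d : ℕ) : ℚ) + 2 * c + 3 * m + 2 := by ring
  have e9 : ((m + k + 1 + d : ℕ) : ℚ) + 2 * c + 1 + 3 * m + 2 =
      ((m + k + 1 + d : ℕ) : ℚ) + 2 * c + 3 * m + 2 + 1 := by ring
  rw [e1, e2, e3, e4, e5, e6, e7, e8, e9, shiftedFactorial, shiftedFactorial,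
    ← rising_eq_ascPochhammer, ← rising_eq_ascPochhammer, h4, ← h3]
  field_simp
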